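/- For positive integers $m,n$ let $\Delta^m_n$ be the graph with vertices $e_1,\dots,e_n$ and $f^k_i$ ($1\le i\le n-1$, $1\le k\le m$), whose edges are $e_i\sim f^k_i$ and $f^k_i\sim e_{i+1}$ for $1\le i\le n-1$, and $f^k_i\sim f^k_{i+1}$ for $1\le i\le n-2$ (with $1\le k\le m$). For a graph $G$, let $I(G)$ be its independence complex, whose simplices are the independent sets of vertices, and let $M(G)$ be its matching complex, whose simplices are the sets of pairwise disjoint edges. Complexes are identified with their geometric realizations, $\Sigma$ denotes reduced suspension, and $\vee$ denotes the wedge sum. For all $n\ge 5$ and $m\ge 2$, and for every choice of base points in the complexes on the right (independently in each summand), there is a homotopy equivalence $$I(\Delta^m_n)\simeq \Sigma^2 I(\Delta^m_{n-3})\vee \Sigma^m I(\Delta^m_{n-3})\vee \Sigma^{m+1} I(\Delta^m_{n-4}).$$ In particular, if $\Gamma_n$ denotes the $n\times 2$ grid graph (vertices $(i,j)$ with $1\le i\le n$, $1\le j\le 2$, where $(i,j)$ and $(i',j')$ are adjacent if and only if $|i-i'|+|j-j'|=1$), then for all $n\ge 5$, and again for every choice of base points, $$M(\Gamma_n)\simeq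 \Sigma^2 M(\Gamma_{n-3})\vee \Sigma^2 M(\Gamma_{n-3})\vee \Sigma^3 M(\Gamma_{n-4}).$$ -/

import Mathlib

open scoped ContinuousMap unitInterval

/-- The graph `Δ^m_n`. Its vertices are `e_i`, written `Sum.inl i` with `i : Fin n`, and `f^k_i`,
written `Sum.inr (i, k)` with `i : Fin (n - 1)` and `k : Fin m`; indices are shifted to start
at `0`. The edges are `e_i ~ f^k_i`, `e_{i+1} ~ f^k_i` and `f^k_i ~ f^k_{i+1}`. -/
def braunHoughGraph (m n : ℕ) : SimpleGraph (Fin n ⊕ (Fin (n - 1) × Fin m)) :=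
  SimpleGraph.fromRel fun v w =>
    match v, w with
    | Sum.inl i, Sum.inr (j, _) => (i : ℕ) = j ∨ (i : ℕ) = j + 1
    | Sum.inr (i, k), Sum.inr (j, l) => (j : ℕ) = i + 1 ∧ k = l
    | _, _ => False

/-- The `m × n` grid graph: two points are adjacent iff their `ℓ¹`-distance is `1`. -/
def gridGraph (m n : ℕ) : SimpleGraph (Fin m × Fin n) where
  Adj p q := |((q.1 : ℕ) : ℤ) - ((p.1 : ℕ) : ℤ)| + |((q.2 : ℕ) : ℤ) - ((p.2 : ℕ) : ℤ)| = 1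
  symm := ⟨fun p q h => by
    rw [abs_sub_comm ((p.1 : ℕ) : ℤ), abs_sub_comm ((p.2 : ℕ) : ℤ)]
    exact h⟩
  loopless := ⟨fun p h => by simp at h⟩

/-- The independence complex of a graph: its simplices are the nonempty finite independent sets
of vertices. -/
def independenceComplex {V : Type*} (G : SimpleGraph V) : AbstractSimplicialComplex V where
  faces := {s | s.Nonempty ∧ G.IsIndepSet (s : Set V)}
  isRelLowerSet_faces := fun _ hs =>
    ⟨hs.1, fun _ hts ht => ⟨ht, hs.2.mono (Finset.coe_subset.2 hts)⟩⟩
  singleton_mem := fun v => ⟨Finset.singleton_nonempty v, by simp⟩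

/-- The matching complex of a graph: its simplices are the nonempty finite matchings, that is,
sets of edges such that every vertex of the graph lies on at most one of them. -/
def matchingComplex {V : Type*} (G : SimpleGraph V) : AbstractSimplicialComplex G.edgeSet where
  faces := {s | s.Nonempty ∧
    ∀ v : V, ∀ e ∈ s, ∀ e' ∈ s, v ∈ (e : Sym2 V) → v ∈ (e' : Sym2 V) → e = e'}
  isRelLowerSet_faces := fun _ hs =>
    ⟨hs.1, fun _ hts ht => ⟨ht, fun v e he e' he' => hs.2 v e (hts he) e' (hts he')⟩⟩
  singleton_mem := fun e => ⟨Finset.singleton_nonempty e, fun v a ha b hb _ _ => by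
    rw [Finset.mem_singleton.1 ha, Finset.mem_singleton.1 hb]⟩

namespace AbstractSimplicialComplex

/-- The geometric realization of a simplicial complex on a finite vertex set `V`, in barycentric
coordinates: the union in `ℝ^V` of the simplices spanned by the standard basis vectors indexed by
the faces. It is used with the subspace topology. -/
def realization {V : Type*} [Finite V] (K : AbstractSimplicialComplex V) : Set (V → ℝ) :=
  {x | (∀ v, 0 ≤ x v) ∧ ∃ s ∈ K.faces, (∀ v, v ∉ s → x v = 0) ∧ ∑ v ∈ s, x v = 1}

end AbstractSimplicialComplex

/-- A topological space with a base point. -/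
structure PointedSpace where
  /-- the underlying type -/
  carrier : Type
  /-- the topology -/
  [top : TopologicalSpace carrier]
  /-- the base point -/
  pt : carrier

attribute [instance] PointedSpace.top

/-- The equivalence relation on `X` that identifies all points of `A` with each other. -/
def collapseSetoid {X : Type*} (A : Set X) : Setoid X where
  r x y := x = y ∨ (x ∈ A ∧ y ∈ A)
  iseqv :=
    { refl := fun _ => Or.inl rfl
      symm := by
        rintro x y (rfl | ⟨hx, hy⟩)
        · exact Or.inl rfl
        · exact Or.inr ⟨hy, hx⟩
      trans := by
        rintro x y z (rfl | ⟨hx, hy⟩) (rfl | ⟨hy', hz⟩)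
        · exact Or.inl rfl
        · exact Or.inr ⟨hy', hz⟩
        · exact Or.inr ⟨hx, hy⟩
        · exact Or.inr ⟨hx, hz⟩ }

namespace PointedSpace

/-- The space `X` with base point `x`. -/
def ofPoint {X : Type} [TopologicalSpace X] (x : X) : PointedSpace := ⟨X, x⟩

/-- Reduced suspension: the quotient of `X × [0, 1]` in which
`X × {0} ∪ X × {1} ∪ {pt} × [0, 1]` is collapsed to the base point. -/
def suspension (X : PointedSpace) : PointedSpace where
  carrier := Quotient
    (collapseSetoid {p : X.carrier × I | p.2 = 0 ∨ p.2 = 1 ∨ p.1 = X.pt})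
  pt := Quotient.mk _ (X.pt, 0)

/-- The `k`-fold reduced suspension. -/
def iteratedSuspension : ℕ → PointedSpace → PointedSpace
  | 0, X => X
  | k + 1, X => (iteratedSuspension k X).suspension

/-- The wedge sum: the disjoint union with the two base points identified. -/
def wedge (X Y : PointedSpace) : PointedSpace where
  carrier := Quotient
    (collapseSetoid ({Sum.inl X.pt, Sum.inr Y.pt} : Set (X.carrier ⊕ Y.carrier)))
  pt := Quotient.mk _ (Sum.inl X.pt)

end PointedSpace

/-! Indices start at 0, and the `k`-th strand consists of the vertices `f^k_i`. Two moves compute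
independence complexes. Folding: if `N(u) ⊆ N(v)`, then sliding `v` linearly onto `u` retracts
`I(G)` onto `I(G - v)` (`indepSpace_equivalent_of_fold`). Splitting: let `L` be the set of vertices
other than `v` that are not adjacent to `v`. Then `I(G)` is the mapping cone of `I(L) → I(G - v)`
(`isMappingCone_indepSpace`). If this inclusion is null-homotopic, the cone is `I(G - v) ∨ Σ I(L)`
(`IsMappingCone.equivalent_wedge_suspension`). Both moves also show that a component consisting of
one edge contributes one suspension.

In `Δ^m_n`, the vertex `e_1` folds onto `e_0`. The link of `e_2` is then a star on `e_0` and the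
`f^k_0`, next to a copy of `Δ^m_{n-3}`. The star folds to an edge, so splitting at `e_2` contributes
`Σ² I(Δ^m_{n-3})`. Its null-homotopy needs `m ≥ 2`: the star is pushed into strand 0, after which
`f^q_0` on another strand is a cone point.

What remains is split at `e_0`. Without `e_0`, folding `f^k_2` onto `f^k_0` leaves the `m` edges
`f^k_0 f^k_1` next to `Δ^m_{n-3}`, hence `Σ^m I(Δ^m_{n-3})`. The link of `e_0` folds to the `m`
edges `f^k_1 f^k_2` next to `Δ^m_{n-4}`, and the cone adds one more suspension.

The equivalences between the pieces are pointed, and the complexes are well-pointed at every point,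
so the base points under the suspensions are arbitrary. The statement on matchings follows because
`Δ^2_n` is the line graph of `Γ_n`. -/

/-! ### Homotopies as maps into path spaces -/

section Homotopies

variable {X Y : Type*} [TopologicalSpace X] [TopologicalSpace Y]

/-- A homotopy in the form `X → C(I, Y)` descends along a quotient of `X` by the universal property
alone. This avoids asking whether the product of a quotient map with `I` is again a quotient map. -/
theorem homotopicRel_of_pathMap {f g : C(X, Y)} {S : Set X} (F : C(X, C(I, Y)))
    (h₀ : ∀ x, F x 0 = f x) (h₁ : ∀ x, F x 1 = g x) (hS : ∀ x ∈ S, ∀ t, F x t = f x) :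
    f.HomotopicRel g S :=
  ⟨{ toFun := fun p => F p.2 p.1
     continuous_toFun := by fun_prop
     map_zero_left := h₀
     map_one_left := h₁
     prop' := fun t x hx => hS x hx t }⟩

theorem ContinuousMap.HomotopicRel.exists_pathMap {f g : C(X, Y)} {S : Set X}
    (h : f.HomotopicRel g S) :
    ∃ F : C(X, C(I, Y)), (∀ x, F x 0 = f x) ∧ (∀ x, F x 1 = g x) ∧
      ∀ x ∈ S, ∀ t, F x t = f x := by
  obtain ⟨H⟩ := h
  refine ⟨ContinuousMap.curry ⟨fun p : X × I => H (p.2, p.1), by fun_prop⟩, fun x => ?_,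
    fun x => ?_, fun x hx t => ?_⟩
  · simp
  · simp
  · exact H.eq_fst t hx

theorem ContinuousMap.HomotopicRel.precomp {W : Type*} [TopologicalSpace W] {f g : C(X, Y)}
    {S : Set X} {T : Set W} (h : f.HomotopicRel g S) (k : C(W, X)) (hk : ∀ w ∈ T, k w ∈ S) :
    (f.comp k).HomotopicRel (g.comp k) T := by
  obtain ⟨F, h₀, h₁, hS⟩ := h.exists_pathMap
  exact homotopicRel_of_pathMap (F.comp k) (fun x => h₀ _) (fun x => h₁ _)
    fun x hx t => hS _ (hk x hx) t

/-- The map induced on the collapse of `A` by a map that is constant on `A`. -/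
def collapseLift {A : Set X} (f : C(X, Y)) (h : ∀ x ∈ A, ∀ y ∈ A, f x = f y) :
    C(Quotient (collapseSetoid A), Y) where
  toFun := Quotient.lift f fun x y hxy => by
    rcases hxy with rfl | ⟨hx, hy⟩
    · rfl
    · exact h x hx y hy
  continuous_toFun := f.continuous.quotient_lift _

end Homotopies

/-! ### Reduced suspensions, wedges and pointed homotopy equivalences -/

namespace PointedSpace

/-- The canonical map from `X × I` to the reduced suspension of `X`. -/
def suspMk (X : PointedSpace) : C(X.carrier × I, X.suspension.carrier) :=
  ⟨fun p => Quotient.mk _ p, continuous_quotient_mk'⟩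

theorem suspMk_eq_pt (X : PointedSpace) {p : X.carrier × I}
    (h : p.2 = 0 ∨ p.2 = 1 ∨ p.1 = X.pt) : X.suspMk p = X.suspension.pt :=
  Quotient.sound (Or.inr ⟨h, Or.inl rfl⟩)

theorem suspMk_surjective (X : PointedSpace) : Function.Surjective X.suspMk :=
  Quotient.mk_surjective

/-- The map out of a reduced suspension induced by a map out of the cylinder. -/
def suspLift {X : PointedSpace} {W : Type*} [TopologicalSpace W] (β : C(X.carrier × I, W)) (w : W)
    (h : ∀ p : X.carrier × I, p.2 = 0 ∨ p.2 = 1 ∨ p.1 = X.pt → β p = w) :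
    C(X.suspension.carrier, W) :=
  collapseLift β fun x hx y hy => (h x hx).trans (h y hy).symm

theorem suspLift_pt {X : PointedSpace} {W : Type*} [TopologicalSpace W] (β : C(X.carrier × I, W))
    (w : W) (h) : suspLift β w h X.suspension.pt = w :=
  h (X.pt, 0) (Or.inl rfl)

/-- The inclusion of the left summand into a wedge. -/
def wedgeInl (X Y : PointedSpace) : C(X.carrier, (X.wedge Y).carrier) :=
  ⟨fun x => Quotient.mk _ (Sum.inl x), continuous_quotient_mk'.comp continuous_inl⟩

/-- The inclusion of the right summand into a wedge. -/
def wedgeInr (X Y : PointedSpace) : C(Y.carrier, (X.wedge Y).carrier) :=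
  ⟨fun x => Quotient.mk _ (Sum.inr x), continuous_quotient_mk'.comp continuous_inr⟩

theorem wedgeInl_pt (X Y : PointedSpace) : wedgeInl X Y X.pt = (X.wedge Y).pt := rfl

theorem wedgeInr_pt (X Y : PointedSpace) : wedgeInr X Y Y.pt = (X.wedge Y).pt :=
  Quotient.sound (Or.inr ⟨by simp, by simp⟩)

/-- The map out of a wedge induced by maps out of the summands. -/
def wedgeLift {X Y : PointedSpace} {W : Type*} [TopologicalSpace W] (α : C(X.carrier, W))
    (β : C(Y.carrier, W)) (h : α X.pt = β Y.pt) : C((X.wedge Y).carrier, W) :=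
  collapseLift ⟨Sum.elim α β, by fun_prop⟩ (by
    rintro x (rfl | rfl) y (rfl | rfl) <;> simp [h])

@[simp]
theorem wedgeLift_inl {X Y : PointedSpace} {W : Type*} [TopologicalSpace W] (α : C(X.carrier, W))
    (β : C(Y.carrier, W)) (h) (x : X.carrier) : wedgeLift α β h (wedgeInl X Y x) = α x := rfl

@[simp]
theorem wedgeLift_inr {X Y : PointedSpace} {W : Type*} [TopologicalSpace W] (α : C(X.carrier, W))
    (β : C(Y.carrier, W)) (h) (y : Y.carrier) : wedgeLift α β h (wedgeInr X Y y) = β y := rfl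

@[simp]
theorem wedgeLift_pt {X Y : PointedSpace} {W : Type*} [TopologicalSpace W] (α : C(X.carrier, W))
    (β : C(Y.carrier, W)) (h) : wedgeLift α β h (X.wedge Y).pt = α X.pt := rfl

theorem wedge_cases {X Y : PointedSpace} {P : (X.wedge Y).carrier → Prop}
    (hl : ∀ x, P (wedgeInl X Y x)) (hr : ∀ y, P (wedgeInr X Y y)) (z) : P z := by
  obtain ⟨x | y, rfl⟩ := Quotient.mk_surjective z
  exacts [hl x, hr y]

theorem wedge_homotopicRel {X Y : PointedSpace} {W : Type*} [TopologicalSpace W]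
    {f g : C((X.wedge Y).carrier, W)}
    (hl : (f.comp (wedgeInl X Y)).HomotopicRel (g.comp (wedgeInl X Y)) {X.pt})
    (hr : (f.comp (wedgeInr X Y)).HomotopicRel (g.comp (wedgeInr X Y)) {Y.pt}) :
    f.HomotopicRel g {(X.wedge Y).pt} := by
  obtain ⟨F, F₀, F₁, hF⟩ := hl.exists_pathMap
  obtain ⟨G, G₀, G₁, hG⟩ := hr.exists_pathMap
  have hFG : F X.pt = G Y.pt := by
    ext t
    rw [hF _ rfl, hG _ rfl]
    exact congrArg f ((wedgeInl_pt X Y).trans (wedgeInr_pt X Y).symm)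
  refine homotopicRel_of_pathMap (wedgeLift F G hFG) (wedge_cases F₀ G₀) (wedge_cases F₁ G₁) ?_
  rintro _ rfl t
  exact hF _ rfl t

theorem susp_homotopicRel {X : PointedSpace} {W : Type*} [TopologicalSpace W]
    {f g : C(X.suspension.carrier, W)}
    (h : (f.comp X.suspMk).HomotopicRel (g.comp X.suspMk)
      {p | p.2 = 0 ∨ p.2 = 1 ∨ p.1 = X.pt}) :
    f.HomotopicRel g {X.suspension.pt} := by
  obtain ⟨F, F₀, F₁, hF⟩ := h.exists_pathMap
  refine homotopicRel_of_pathMap (suspLift F (.const _ (f X.suspension.pt)) fun p hp => ?_)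
    (fun z => ?_) (fun z => ?_) ?_
  · ext t
    rw [hF p hp t, ContinuousMap.comp_apply, X.suspMk_eq_pt hp]
    rfl
  · obtain ⟨p, rfl⟩ := X.suspMk_surjective z
    exact F₀ p
  · obtain ⟨p, rfl⟩ := X.suspMk_surjective z
    exact F₁ p
  · rintro _ rfl t
    rw [suspLift_pt]
    rfl

/-- Pointed homotopy equivalence. -/
def Equivalent (X Y : PointedSpace) : Prop :=
  ∃ (f : C(X.carrier, Y.carrier)) (g : C(Y.carrier, X.carrier)),
    f X.pt = Y.pt ∧ g Y.pt = X.pt ∧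
      (g.comp f).HomotopicRel (.id _) {X.pt} ∧ (f.comp g).HomotopicRel (.id _) {Y.pt}

namespace Equivalent

theorem refl (X : PointedSpace) : X.Equivalent X :=
  ⟨.id _, .id _, rfl, rfl, .refl _, .refl _⟩

theorem symm {X Y : PointedSpace} : X.Equivalent Y → Y.Equivalent X
  | ⟨f, g, hf, hg, h, h'⟩ => ⟨g, f, hg, hf, h', h⟩

theorem trans {X Y Z : PointedSpace} : X.Equivalent Y → Y.Equivalent Z → X.Equivalent Z
  | ⟨f, g, hf, hg, h, h'⟩, ⟨f', g', hf', hg', k, k'⟩ => by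
    refine ⟨f'.comp f, g.comp g', by simp [hf, hf'], by simp [hg, hg'], ?_, ?_⟩
    · exact ((k.precomp f (T := {X.pt}) (by simp [hf])).comp_continuousMap g).trans h
    · exact ((h'.precomp g' (T := {Z.pt}) (by simp [hg'])).comp_continuousMap f').trans k'

theorem homotopyEquiv {X Y : PointedSpace} :
    X.Equivalent Y → Nonempty (X.carrier ≃ₕ Y.carrier)
  | ⟨f, g, _, _, h, h'⟩ => ⟨⟨f, g, h.homotopic, h'.homotopic⟩⟩

theorem of_homeomorph {X Y : PointedSpace} (e : X.carrier ≃ₜ Y.carrier) (h : e X.pt = Y.pt) :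
    X.Equivalent Y := by
  refine ⟨e, e.symm, h, by simp [← h], ?_, ?_⟩
  · convert ContinuousMap.HomotopicRel.refl _
    ext; simp
  · convert ContinuousMap.HomotopicRel.refl _
    ext; simp

theorem wedge {X X' Y Y' : PointedSpace} :
    X.Equivalent X' → Y.Equivalent Y' → (X.wedge Y).Equivalent (X'.wedge Y')
  | ⟨f, g, hf, hg, h, h'⟩, ⟨f', g', hf', hg', k, k'⟩ => by
    refine ⟨wedgeLift ((wedgeInl _ _).comp f) ((wedgeInr _ _).comp f') ?_,
      wedgeLift ((wedgeInl _ _).comp g) ((wedgeInr _ _).comp g') ?_, ?_, ?_,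
      wedge_homotopicRel ?_ ?_, wedge_homotopicRel ?_ ?_⟩
    · simp [hf, hf', wedgeInl_pt, wedgeInr_pt]
    · simp [hg, hg', wedgeInl_pt, wedgeInr_pt]
    · simp [hf, wedgeInl_pt]
    · simp [hg, wedgeInl_pt]
    · exact h.comp_continuousMap (wedgeInl X Y)
    · exact k.comp_continuousMap (wedgeInr X Y)
    · exact h'.comp_continuousMap (wedgeInl X' Y')
    · exact k'.comp_continuousMap (wedgeInr X' Y')

theorem wedge_comm (X Y : PointedSpace) : (X.wedge Y).Equivalent (Y.wedge X) := by
  refine ⟨wedgeLift (wedgeInr _ _) (wedgeInl _ _) ?_, wedgeLift (wedgeInr _ _) (wedgeInl _ _) ?_,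
    ?_, ?_, wedge_homotopicRel ?_ ?_, wedge_homotopicRel ?_ ?_⟩
  · simp [wedgeInl_pt, wedgeInr_pt]
  · simp [wedgeInl_pt, wedgeInr_pt]
  · exact wedgeInr_pt _ _
  · exact wedgeInr_pt _ _
  all_goals exact .refl _

theorem wedge_assoc (X Y Z : PointedSpace) :
    (X.wedge (Y.wedge Z)).Equivalent ((X.wedge Y).wedge Z) := by
  refine ⟨wedgeLift ((wedgeInl _ _).comp (wedgeInl _ _))
      (wedgeLift ((wedgeInl _ _).comp (wedgeInr _ _)) (wedgeInr _ _) ?_) ?_,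
    wedgeLift (wedgeLift (wedgeInl _ _) ((wedgeInr _ _).comp (wedgeInl _ _)) ?_)
      ((wedgeInr _ _).comp (wedgeInr _ _)) ?_, ?_, ?_, wedge_homotopicRel ?_
      (wedge_homotopicRel ?_ ?_), wedge_homotopicRel (wedge_homotopicRel ?_ ?_) ?_⟩
  · simp [wedgeInl_pt, wedgeInr_pt]
  · simp [wedgeInl_pt, wedgeInr_pt]
  · simp [wedgeInl_pt, wedgeInr_pt]
  · simp only [ContinuousMap.comp_apply, wedgeInr_pt]
    rfl
  · rfl
  · rfl
  all_goals exact .refl _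

/-- A wedge with a pointed-contractible summand. -/
theorem wedge_of_contractible {X : PointedSpace} (Y : PointedSpace)
    (h : (ContinuousMap.const X.carrier X.pt).HomotopicRel (.id _) {X.pt}) :
    (X.wedge Y).Equivalent Y := by
  refine ⟨wedgeLift (.const _ Y.pt) (.id _) rfl, wedgeInr _ _, rfl, wedgeInr_pt _ _,
    wedge_homotopicRel ?_ ?_, ?_⟩
  · convert h.comp_continuousMap (wedgeInl X Y) using 1
    · ext x
      exact (wedgeInr_pt X Y).trans (wedgeInl_pt X Y).symm
    · rfl
  all_goals exact .refl _

theorem suspension {X Y : PointedSpace} :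
    X.Equivalent Y → X.suspension.Equivalent Y.suspension := by
  rintro ⟨f, g, hf, hg, h, h'⟩
  have key : ∀ (X Y : PointedSpace) (f : C(X.carrier, Y.carrier)), f X.pt = Y.pt →
      ∀ p : X.carrier × I, p.2 = 0 ∨ p.2 = 1 ∨ p.1 = X.pt →
        (Y.suspMk.comp (f.prodMap (.id I))) p = Y.suspension.pt := by
    intro X Y f hf p hp
    refine Y.suspMk_eq_pt ?_
    rcases hp with hp | hp | hp
    · exact Or.inl hp
    · exact Or.inr (Or.inl hp)
    · exact Or.inr (Or.inr (by simp [hp, hf]))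
  have key' : ∀ (X : PointedSpace) (k : C(X.carrier, X.carrier)),
      k.HomotopicRel (.id _) {X.pt} → (X.suspMk.comp (k.prodMap (.id I))).HomotopicRel X.suspMk
        {p | p.2 = 0 ∨ p.2 = 1 ∨ p.1 = X.pt} := by
    intro X k hk
    obtain ⟨F, F₀, F₁, hF⟩ := hk.exists_pathMap
    have hkpt : k X.pt = X.pt := hk.fst_eq_snd rfl
    refine homotopicRel_of_pathMap (ContinuousMap.curry
      ⟨fun q : (X.carrier × I) × I => X.suspMk (F q.1.1 q.2, q.1.2), by fun_prop⟩)
      (fun p => ?_) (fun p => ?_) fun p hp t => ?_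
    · simp [F₀]; rfl
    · simp [F₁]
    · refine (X.suspMk_eq_pt ?_).trans (key X X k hkpt p hp).symm
      rcases hp with hp | hp | hp
      · exact Or.inl hp
      · exact Or.inr (Or.inl hp)
      · exact Or.inr (Or.inr (by simp [hp, hF, hkpt]))
  refine ⟨suspLift _ _ (key X Y f hf), suspLift _ _ (key Y X g hg), suspLift_pt _ _ _,
    suspLift_pt _ _ _, susp_homotopicRel ?_, susp_homotopicRel ?_⟩
  · exact key' X _ h
  · exact key' Y _ h'

theorem iteratedSuspension {X Y : PointedSpace} (h : X.Equivalent Y) :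
    ∀ k, (iteratedSuspension k X).Equivalent (iteratedSuspension k Y)
  | 0 => h
  | k + 1 => (iteratedSuspension h k).suspension

end Equivalent

end PointedSpace

/-! ### Mapping cones of null-homotopic maps -/

theorem ContinuousMap.HomotopicRel.mono {X Y : Type*} [TopologicalSpace X] [TopologicalSpace Y]
    {f g : C(X, Y)} {S T : Set X} (h : f.HomotopicRel g S) (hT : T ⊆ S) : f.HomotopicRel g T :=
  h.precomp (.id X) hT

/-- `Z` is the mapping cone of `f : X → Y`: it is glued from `Y`, by way of `j`, and the cylinder
on `X`, by way of `c`, along `f` at the bottom, with the top collapsed. -/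
structure IsMappingCone {X Y Z : Type} [TopologicalSpace X] [TopologicalSpace Y]
    [TopologicalSpace Z] (f : C(X, Y)) (j : C(Y, Z)) (c : C(X × I, Z)) : Prop where
  base : ∀ x, c (x, 0) = j (f x)
  apex : ∀ x x', c (x, 1) = c (x', 1)
  cover : ∀ z, (∃ y, j y = z) ∨ ∃ p, c p = z
  desc : ∀ {W : Type} [TopologicalSpace W] (α : C(Y, W)) (β : C(X × I, W)),
    (∀ x, β (x, 0) = α (f x)) → (∀ x x', β (x, 1) = β (x', 1)) →
      ∃ γ : C(Z, W), (∀ y, γ (j y) = α y) ∧ ∀ p, γ (c p) = β p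

/-- The point `b` has a neighborhood `{μ < 1}` that can be contracted to `b` by a deformation of
the whole space fixing `b`. -/
def IsWellPointed {X : Type} [TopologicalSpace X] (b : X) : Prop :=
  ∃ (μ : C(X, I)) (D : C(X, C(I, X))), μ b = 0 ∧ (∀ x, D x 0 = x) ∧ (∀ s, D b s = b) ∧
    ∀ x, μ x = 1 ∨ D x 1 = b

/-- The retraction of the real line onto the unit interval. -/
noncomputable def clamp : C(ℝ, I) := ⟨Set.projIcc 0 1 zero_le_one, continuous_projIcc⟩

theorem clamp_of_nonpos {t : ℝ} (h : t ≤ 0) : clamp t = 0 := Set.projIcc_of_le_left zero_le_one h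

theorem clamp_of_one_le {t : ℝ} (h : 1 ≤ t) : clamp t = 1 := Set.projIcc_of_right_le zero_le_one h

theorem clamp_coe (t : I) : clamp t = t := Set.projIcc_val zero_le_one t

theorem coe_clamp {t : ℝ} (h₀ : 0 ≤ t) (h₁ : t ≤ 1) : (clamp t : ℝ) = t := by
  simp [clamp, Set.projIcc_of_mem zero_le_one ⟨h₀, h₁⟩]

-- This packages the universal property of `Y ∨ ΣX`, for maps and for homotopies, in terms of `Y`
-- and the cylinder on `X`, so that the quotients need not be opened again.
open PointedSpace in
theorem exists_wedge_suspension_maps {X Y : Type} [TopologicalSpace X] [TopologicalSpace Y]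
    (y₀ : Y) (b : X) :
    ∃ (inl : C(Y, ((ofPoint y₀).wedge (ofPoint b).suspension).carrier))
      (inr : C(X × I, ((ofPoint y₀).wedge (ofPoint b).suspension).carrier)),
      inl y₀ = ((ofPoint y₀).wedge (ofPoint b).suspension).pt ∧
      (∀ x t, t = 0 ∨ t = 1 ∨ x = b → inr (x, t) = inl y₀) ∧
      (∀ {Z : Type} [TopologicalSpace Z] (α : C(Y, Z)) (β : C(X × I, Z)),
        (∀ x t, t = 0 ∨ t = 1 ∨ x = b → β (x, t) = α y₀) →
          ∃ r : C(((ofPoint y₀).wedge (ofPoint b).suspension).carrier, Z),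
            (∀ y, r (inl y) = α y) ∧ ∀ p, r (inr p) = β p) ∧
      ∀ {Z : Type} [TopologicalSpace Z]
        {u v : C(((ofPoint y₀).wedge (ofPoint b).suspension).carrier, Z)},
        u.comp inl = v.comp inl →
        (u.comp inr).HomotopicRel (v.comp inr) {p | p.2 = 0 ∨ p.2 = 1 ∨ p.1 = b} →
          u.HomotopicRel v {((ofPoint y₀).wedge (ofPoint b).suspension).pt} := by
  refine ⟨wedgeInl (ofPoint y₀) _, (wedgeInr _ (ofPoint b).suspension).comp (ofPoint b).suspMk,
    rfl, fun x t hp => ?_, fun {Z} _ α β h => ?_,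
    fun {Z} _ {u v} hl hr => wedge_homotopicRel ?_ ?_⟩
  · exact (congrArg (wedgeInr (ofPoint y₀) _)
      (suspMk_eq_pt (ofPoint b) (p := (x, t)) hp)).trans (wedgeInr_pt _ _)
  · exact ⟨wedgeLift (X := ofPoint y₀) (Y := (ofPoint b).suspension) α
      (suspLift (X := ofPoint b) β (α y₀) fun p hp => h p.1 p.2 hp)
      (suspLift_pt (X := ofPoint b) _ _ _).symm, fun _ => rfl, fun _ => rfl⟩
  · exact (show u.comp (wedgeInl (ofPoint y₀) _) = _ from hl) ▸ .refl _
  · exact susp_homotopicRel (X := ofPoint b) hr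

namespace IsMappingCone

variable {X Y Z : Type} [TopologicalSpace X] [TopologicalSpace Y] [TopologicalSpace Z]
  {f : C(X, Y)} {j : C(Y, Z)} {c : C(X × I, Z)}

/-- The universal property of the cone is applied with target the path space `C(I, W)`: constant
paths on the base, the given homotopy on the cylinder. -/
theorem homotopicRel (hc : IsMappingCone f j c) {W : Type} [TopologicalSpace W] {u v : C(Z, W)}
    (H : C((X × I) × I, W)) (hj : ∀ y, u (j y) = v (j y))
    (h₀ : ∀ p, H (p, 0) = u (c p)) (h₁ : ∀ p, H (p, 1) = v (c p))
    (hbase : ∀ x s, H ((x, 0), s) = u (j (f x)))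
    (hapex : ∀ x x' s, H ((x, 1), s) = H ((x', 1), s)) : u.HomotopicRel v (Set.range j) := by
  obtain ⟨γ, hγj, hγc⟩ := hc.desc (W := C(I, W))
    (ContinuousMap.curry ⟨fun p : Y × I => u (j p.1), by fun_prop⟩) H.curry
    (fun x => by ext s; exact hbase x s) (fun x x' => by ext s; exact hapex x x' s)
  refine homotopicRel_of_pathMap γ (fun z => ?_) (fun z => ?_) ?_
  · obtain ⟨y, rfl⟩ | ⟨p, rfl⟩ := hc.cover z
    · rw [hγj]; rfl
    · rw [hγc]; exact h₀ p
  · obtain ⟨y, rfl⟩ | ⟨p, rfl⟩ := hc.cover z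
    · rw [hγj, ← hj]; rfl
    · rw [hγc]; exact h₁ p
  · rintro _ ⟨y, rfl⟩ t
    rw [hγj]; rfl

open PointedSpace

/-- The mapping cone of a null-homotopic map splits off a suspension. -/
theorem equivalent_wedge_suspension (hc : IsMappingCone f j c) {y₀ : Y} (h : C(X × I, Y))
    (h₀ : ∀ x, h (x, 0) = f x) (h₁ : ∀ x, h (x, 1) = y₀) {b : X} (hb : IsWellPointed b) :
    (ofPoint (j y₀)).Equivalent ((ofPoint y₀).wedge (ofPoint b).suspension) := by
  obtain ⟨μ, D, hμ, hD₀, hDb, hD₁⟩ := hb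
  -- the path from `y₀` to the apex of the cone through `x`
  obtain ⟨A, hA⟩ : ∃ A : C(X × ℝ, Z), ∀ x τ, A (x, τ) =
      if τ ≤ 0 then j (h (x, clamp (-τ))) else c (x, clamp τ) := by
    refine ⟨⟨fun p => if p.2 ≤ 0 then j (h (p.1, clamp (-p.2))) else c (p.1, clamp p.2), ?_⟩,
      fun x τ => rfl⟩
    refine Continuous.if_le (by fun_prop) (by fun_prop) (by fun_prop) (by fun_prop) ?_
    rintro ⟨x, τ⟩ (rfl : τ = 0)
    simp [clamp_of_nonpos, h₀, hc.base]
  have hA_nonpos : ∀ x τ, τ ≤ 0 → A (x, τ) = j (h (x, clamp (-τ))) := fun x τ hτ => by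
    rw [hA, if_pos hτ]
  have hA_start : ∀ x τ, τ ≤ -1 → A (x, τ) = j y₀ := fun x τ hτ => by
    rw [hA_nonpos x τ (by linarith), clamp_of_one_le (by linarith), h₁]
  have hA_cone : ∀ x (t : I), A (x, t) = c (x, t) := fun x t => by
    rcases eq_or_ne t 0 with rfl | ht
    · rw [hA_nonpos _ _ (by simp)]
      simp [clamp_of_nonpos, h₀, hc.base]
    · have ht' : ¬(t : ℝ) ≤ 0 := not_le.2 (unitInterval.pos_iff_ne_zero.2 ht)
      rw [hA, if_neg ht', clamp_coe]
  have hA_apex : ∀ x x' τ τ', 1 ≤ τ → 1 ≤ τ' → A (x, τ) = A (x', τ') :=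
    fun x x' τ τ' hτ hτ' => by
      rw [hA, hA, if_neg (by linarith), if_neg (by linarith), clamp_of_one_le hτ,
        clamp_of_one_le hτ']
      exact hc.apex x x'
  -- the loop at `y₀` through the cone: up along `x` and down along `b`, cut off according to `m`
  have hR : ∀ {Q : Type} [TopologicalSpace Q] (x : C(Q, X)) (m t : C(Q, ℝ)),
      (∀ q, m q = 1 ∨ x q = b) → Continuous fun q => if t q ≤ 1 / 2 then
        A (x q, -1 + 4 * t q * m q) else A (b, -1 + 4 * (1 - t q) * m q) := by
    intro Q _ x m t hx
    refine Continuous.if_le (by fun_prop) (by fun_prop) (by fun_prop) (by fun_prop) ?_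
    intro q hq
    rcases hx q with hq' | hq'
    · rw [hq, hq']; exact hA_apex _ _ _ _ (by norm_num) (by norm_num)
    · rw [hq, hq']; norm_num
  -- The parameter of `A` is `-1` at `y₀` and `1` at the apex. The factor `μ` shortens the loop, to
  -- the constant one at `b`, as reduced suspension demands. At `t = 1/2` the two halves agree:
  -- either `μ = 1` and both are at the apex, or `D x 1 = b` and both lie on the same path.
  obtain ⟨r₀, hr₀⟩ : ∃ r₀ : C(X × I, Z), ∀ p, r₀ p = if (p.2 : ℝ) ≤ 1 / 2 then
      A (D p.1 1, -1 + 4 * p.2 * μ p.1) else A (b, -1 + 4 * (1 - p.2) * μ p.1) :=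
    ⟨⟨_, hR (Q := X × I) ⟨fun p => D p.1 1, by fun_prop⟩ ⟨fun p => μ p.1, by fun_prop⟩
      ⟨fun p => p.2, by fun_prop⟩ fun p => (hD₁ p.1).imp_left fun hp => by simp [hp]⟩,
      fun p => rfl⟩
  have hr₀_pt : ∀ x t, t = 0 ∨ t = 1 ∨ x = b → r₀ (x, t) = j y₀ := by
    rintro x t (rfl | rfl | rfl) <;> rw [hr₀] <;> norm_num [hA_start, hμ]
  obtain ⟨inl, inr, hinl, hinr, lift, homotopicRel_wedge⟩ := exists_wedge_suspension_maps y₀ b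
  obtain ⟨r, hrl, hrr⟩ := lift j r₀ hr₀_pt
  -- the paths `A`, with the part in `Y` cancelled gradually, in the wedge
  obtain ⟨B, hB⟩ : ∃ B : C((X × ℝ) × I, ((ofPoint y₀).wedge (ofPoint b).suspension).carrier),
      ∀ x τ s, B ((x, τ), s) = if τ ≤ 1 / 2 then
        inl (h (x, clamp (max s (max (-τ) (2 * τ))))) else inr (x, clamp (2 * τ - 1)) := by
    refine ⟨⟨fun p => if p.1.2 ≤ 1 / 2 then
      inl (h (p.1.1, clamp (max p.2 (max (-p.1.2) (2 * p.1.2)))))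
        else inr (p.1.1, clamp (2 * p.1.2 - 1)), ?_⟩, fun x τ s => rfl⟩
    refine Continuous.if_le (by fun_prop) (by fun_prop) (by fun_prop) (by fun_prop) ?_
    rintro ⟨⟨x, τ⟩, s⟩ (rfl : τ = 1 / 2)
    rw [hinr _ _ (Or.inl (clamp_of_nonpos (by norm_num))), clamp_of_one_le (by norm_num), h₁]
  have hB_start : ∀ x τ s, τ ≤ -1 → B ((x, τ), s) = inl y₀ := fun x τ s hτ => by
    rw [hB, if_pos (by linarith), clamp_of_one_le, h₁]
    exact le_max_of_le_right (le_max_of_le_left (by linarith))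
  have hB_apex : ∀ x τ s, 1 ≤ τ → B ((x, τ), s) = inl y₀ := fun x τ s hτ => by
    rw [hB, if_neg (by linarith), clamp_of_one_le (by linarith), hinr _ _ (by simp)]
  have hB_one : ∀ x τ, B ((x, τ), 1) = inr (x, clamp (2 * τ - 1)) := fun x τ => by
    rw [hB]
    split_ifs with hτ
    · rw [clamp_of_one_le (by simp), h₁, clamp_of_nonpos (by linarith), hinr _ _ (by simp)]
    · rfl
  -- The pinch map: the lower half of the cone runs along the null-homotopy in `Y`, the upper half
  -- becomes the suspension.
  obtain ⟨q, hqj, hqc⟩ := hc.desc inl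
      (B.comp ⟨fun p : X × I => ((p.1, (p.2 : ℝ)), 0), by fun_prop⟩) (fun x => by
        simp [hB, h₀, clamp_of_nonpos]) (fun x x' => by
        simp [hB_apex])
  have hqA : ∀ x τ, q (A (x, τ)) = B ((x, τ), 0) := by
    intro x τ
    rcases le_total τ 0 with hτ | hτ
    · rw [hA_nonpos _ _ hτ, hqj, hB, if_pos (by linarith), max_eq_left (by linarith : 2 * τ ≤ -τ),
        Set.Icc.coe_zero, max_eq_right (by linarith)]
    · rcases le_total τ 1 with hτ' | hτ'
      · lift τ to I using ⟨hτ, hτ'⟩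
        rw [hA_cone, hqc]
        rfl
      · rw [hA_apex x x τ (1 : I) hτ' (by simp), hA_cone, hqc, hB_apex _ _ _ hτ']
        exact hB_apex _ _ _ (by simp)
  refine ⟨q, r, (hqj y₀).trans hinl, (congrArg r hinl.symm).trans (hrl y₀), ?_, ?_⟩
  · -- the loop through the cone is contracted along `L`
    obtain ⟨L, hL⟩ : ∃ L : C(X × ℝ, Z), ∀ x τ, L (x, τ) =
        if τ ≤ 1 then A (x, τ) else A (b, 2 - τ) := by
      refine ⟨⟨fun p => if p.2 ≤ 1 then A (p.1, p.2) else A (b, 2 - p.2), ?_⟩, fun x τ => rfl⟩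
      refine Continuous.if_le A.continuous (by fun_prop) (by fun_prop) (by fun_prop) ?_
      rintro ⟨x, τ⟩ (rfl : τ = 1)
      exact hA_apex _ _ _ _ le_rfl (by norm_num)
    have hL_end : ∀ x x' τ, 1 ≤ τ → L (x, τ) = L (x', τ) := fun x x' τ hτ => by
      rw [hL, hL]
      split_ifs
      · exact hA_apex _ _ _ _ hτ hτ
      · rfl
    have hL_zero : ∀ x, L (x, 0) = j (f x) := fun x => by
      rw [hL, if_pos zero_le_one, ← hc.base, ← hA_cone]
      rfl
    -- `K` is `r ∘ q` with the full loop through `x` itself. The parameter falls from `0` to `-1` on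
    -- `t ≤ 1/2`, then rises to `3`, passing the apex at `1` and returning along `b`. The two linear
    -- pieces cross at `t = 1/2`.
    obtain ⟨K, hKj, hKc⟩ := hc.desc j
      (L.comp ⟨fun p : X × I => (p.1, max (-2 * p.2) (8 * p.2 - 5)), by fun_prop⟩)
      (fun x => by norm_num [hL_zero]) (fun x x' => hL_end x x' _ (by norm_num))
    have hKc' : ∀ x (t : I), K (c (x, t)) = L (x, max (-2 * (t : ℝ)) (8 * t - 5)) :=
      fun x t => hKc (x, t)
    have hrqc : ∀ x t, r (q (c (x, t))) = if (t : ℝ) ≤ 1 / 2 then A (x, -2 * t) else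
        r₀ (x, clamp (2 * t - 1)) := fun x t => by
      rw [hqc]
      simp only [ContinuousMap.comp_apply, ContinuousMap.coe_mk]
      rw [hB]
      have ht := t.2.1
      split_ifs
      · rw [hrl, hA_nonpos _ _ (by linarith)]
        congr 4
        rw [Set.Icc.coe_zero, max_eq_right (by linarith : -(t : ℝ) ≤ 2 * t),
          max_eq_right (by linarith)]
        ring
      · rw [hrr]
    refine ContinuousMap.HomotopicRel.trans (g := K) ?_ ?_
    -- For `s ≤ 1/2` the factor `μ` is raised to `1` while `D` stays at time `1`; afterwards `D` is
    -- undone. At each moment the two halves of the loop match for one of the two reasons in `hR`.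
    · obtain ⟨H, hH⟩ : ∃ H : C((X × I) × I, Z), ∀ x t s, H ((x, t), s) =
          if (t : ℝ) ≤ 1 / 2 then A (x, -2 * t) else if (2 * t - 1 : ℝ) ≤ 1 / 2 then
            A (D x (clamp (2 - 2 * s)), -1 + 4 * (2 * t - 1) * clamp (max (μ x) (2 * s))) else
              A (b, -1 + 4 * (1 - (2 * t - 1)) * clamp (max (μ x) (2 * s))) := by
        have hcont := hR (Q := (X × I) × I) ⟨fun p => D p.1.1 (clamp (2 - 2 * p.2)), by fun_prop⟩
          ⟨fun p => clamp (max (μ p.1.1) (2 * p.2)), by fun_prop⟩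
          ⟨fun p => 2 * p.1.2 - 1, by fun_prop⟩ ?_
        · refine ⟨⟨fun p => if (p.1.2 : ℝ) ≤ 1 / 2 then A (p.1.1, -2 * p.1.2) else _,
            Continuous.if_le (by fun_prop) hcont (by fun_prop) (by fun_prop) ?_⟩,
            fun x t s => rfl⟩
          rintro ⟨⟨x, t⟩, s⟩ (ht : (t : ℝ) = 1 / 2)
          simp only [ContinuousMap.coe_mk, ht]
          rw [if_pos (by norm_num), hA_start _ _ (by norm_num), hA_start _ _ (by norm_num)]
        · rintro ⟨⟨x, t⟩, s⟩
          simp only [ContinuousMap.coe_mk]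
          rcases le_total (s : ℝ) (1 / 2) with hs | hs
          · rcases hD₁ x with hx | hx
            · left
              change ((clamp (max (μ x : ℝ) (2 * s)) : I) : ℝ) = 1
              rw [clamp_of_one_le (le_max_of_le_left (by simp [hx]))]
              rfl
            · right
              rw [clamp_of_one_le (by linarith), hx]
          · left
            change ((clamp (max (μ x : ℝ) (2 * s)) : I) : ℝ) = 1
            rw [clamp_of_one_le (le_max_of_le_right (by linarith))]
            rfl
      have hH_top : ∀ x s, H ((x, 1), s) = j y₀ := fun x s => by
        rw [hH]
        norm_num [hA_start]
      refine (hc.homotopicRel (u := r.comp q) (v := K) H (fun y => ?_) ?_ ?_ (fun x s => ?_)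
        (fun x x' s => (hH_top x s).trans (hH_top x' s).symm)).mono
          (Set.singleton_subset_iff.2 ⟨y₀, rfl⟩)
      · simp [hqj, hrl, hKj]
      · rintro ⟨x, t⟩
        have ht := t.2.2
        rw [hH, ContinuousMap.comp_apply, hrqc]
        split_ifs with h₁ h₂
        · rfl
        · rw [hr₀]
          simp only
          rw [coe_clamp (t := 2 * (t : ℝ) - 1) (by linarith) (by linarith), if_pos h₂,
            Set.Icc.coe_zero,
            clamp_of_one_le (t := 2 - 2 * 0) (by norm_num), mul_zero, max_eq_left (μ x).2.1,
            clamp_coe]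
        · rw [hr₀]
          simp only
          rw [coe_clamp (t := 2 * (t : ℝ) - 1) (by linarith) (by linarith), if_neg h₂,
            Set.Icc.coe_zero, mul_zero,
            max_eq_left (μ x).2.1, clamp_coe]
      · rintro ⟨x, t⟩
        have ht := t.2.2
        rw [hH, hKc', hL,
          clamp_of_one_le (t := max _ _) (by simp), Set.Icc.coe_one,
          clamp_of_nonpos (t := 2 - 2 * 1) (by norm_num), hD₀]
        split_ifs with h₁ h₂ h₃ h₄ h₅
        · rw [max_eq_left (by linarith)]
        · exact absurd (max_le (by linarith [t.2.1]) (by linarith)) h₂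
        · rw [max_eq_right (by linarith)]
          congr 2
          ring
        · exact absurd (max_le (by linarith [t.2.1]) (by linarith)) h₄
        · linarith [le_max_right (-2 * (t : ℝ)) (8 * t - 5)]
        · rw [max_eq_right (by linarith)]
          congr 2
          ring
      · rw [hH]
        norm_num [hqj, hrl]
        rw [← hc.base, ← hA_cone]
        rfl
    -- The parameter is moved linearly to `t`. At `t = 1` it stays at least `1`, where `L` does not
    -- depend on `x`, so the homotopy descends to the cone.
    · obtain ⟨H, hH⟩ : ∃ H : C((X × I) × I, Z), ∀ x t s, H ((x, t), s) =
          L (x, (1 - s) * max (-2 * (t : ℝ)) (8 * t - 5) + s * t) :=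
        ⟨⟨fun p => L (p.1.1, (1 - p.2) * max (-2 * (p.1.2 : ℝ)) (8 * p.1.2 - 5) + p.2 * p.1.2),
          by fun_prop⟩, fun x t s => rfl⟩
      refine (hc.homotopicRel (u := K) (v := .id Z) H hKj ?_ ?_ (fun x s => ?_)
        (fun x x' s => ?_)).mono
          (Set.singleton_subset_iff.2 ⟨y₀, rfl⟩)
      · rintro ⟨x, t⟩
        rw [hH, hKc']
        simp
      · rintro ⟨x, t⟩
        rw [hH]
        simp only [Set.Icc.coe_one, sub_self, zero_mul, zero_add, one_mul,
          ContinuousMap.id_apply]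
        rw [hL, if_pos t.2.2, hA_cone]
      · rw [hH, hKj, ← hL_zero]
        norm_num
      · rw [hH, hH]
        refine hL_end _ _ _ ?_
        have := s.2.2
        norm_num
        linarith
  · refine homotopicRel_wedge ?_ ?_
    · ext y
      exact (congrArg q (hrl y)).trans (hqj y)
    · have hμD : ∀ x, (μ x : ℝ) = 1 ∨ D x 1 = b := fun x => (hD₁ x).imp_left fun hx => by simp [hx]
      -- Letting `s` in `B` go to `1` cancels the excursion through `Y`. The rising half becomes `2
      -- * (-1 + 4 * t) - 1 = 8 * t - 3` when `μ = 1`; the returning half along `b` is constant. It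
      -- remains to undo `D` and reparametrize.
      refine ContinuousMap.HomotopicRel.trans
        (g := ⟨fun p : X × I => inr (D p.1 1, clamp (8 * p.2 - 3)), by fun_prop⟩) ?_ ?_
      · obtain ⟨H, hH⟩ : ∃ H : C((X × I) × I, _), ∀ x t s, H ((x, t), s) =
            if (t : ℝ) ≤ 1 / 2 then B ((D x 1, -1 + 4 * t * μ x), s) else
              B ((b, -1 + 4 * (1 - t) * μ x), s) := by
          refine ⟨⟨fun p => if (p.1.2 : ℝ) ≤ 1 / 2 then
            B ((D p.1.1 1, -1 + 4 * p.1.2 * μ p.1.1), p.2) else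
              B ((b, -1 + 4 * (1 - p.1.2) * μ p.1.1), p.2),
            Continuous.if_le (by fun_prop) (by fun_prop) (by fun_prop) (by fun_prop) ?_⟩,
            fun x t s => rfl⟩
          rintro ⟨⟨x, t⟩, s⟩ (ht : (t : ℝ) = 1 / 2)
          simp only [ht]
          rcases hμD x with hx | hx
          · rw [hB_apex _ _ _ (by norm_num [hx]), hB_apex _ _ _ (by norm_num [hx])]
          · rw [hx]; norm_num
        have hH₀ : ∀ x t, H ((x, t), 0) = q (r (inr (x, t))) := fun x t => by
          rw [hrr, hr₀, hH, apply_ite q, hqA, hqA]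
        refine homotopicRel_of_pathMap H.curry (fun p => hH₀ p.1 p.2) ?_ ?_
        · rintro ⟨x, t⟩
          have ht := t.2.1
          simp only [ContinuousMap.curry_apply, hH, hB_one, ContinuousMap.coe_mk]
          split_ifs with ht'
          · rcases hμD x with hx | hx
            · rw [hx]
              congr 3
              ring
            · rw [hx, hinr _ _ (by simp), hinr _ _ (by simp)]
          · rw [hinr b _ (by simp), clamp_of_one_le (by linarith), hinr _ _ (by simp)]
        · intro p hp s
          have hHp : ∀ s, H (p, s) = inl y₀ := by
            intro s
            obtain ⟨x, t⟩ := p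
            rw [hH]
            obtain rfl | rfl | rfl : t = 0 ∨ t = 1 ∨ x = b := hp
            all_goals norm_num [hB_start, hμ]
          exact (hHp s).trans ((hHp 0).symm.trans (hH₀ p.1 p.2))
      · obtain ⟨H, hH⟩ : ∃ H : C((X × I) × I, _), ∀ x t s, H ((x, t), s) =
            inr (D x (σ s), clamp ((1 - s) * clamp (8 * t - 3) + s * t)) :=
          ⟨⟨fun p => inr (D p.1.1 (σ p.2),
            clamp ((1 - p.2) * clamp (8 * p.1.2 - 3) + p.2 * p.1.2)), by fun_prop⟩,
            fun x t s => rfl⟩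
        have hH₀ : ∀ x t, H ((x, t), 0) = inr (D x 1, clamp (8 * t - 3)) := fun x t => by
          simp [hH, clamp_coe]
        refine homotopicRel_of_pathMap H.curry (fun p => hH₀ p.1 p.2) ?_ ?_
        · rintro ⟨x, t⟩
          simp [hH, clamp_coe, hD₀]
        · intro p hp s
          have hHp : ∀ s, H (p, s) = inl y₀ := by
            intro s
            obtain ⟨x, t⟩ := p
            rw [hH]
            obtain rfl | rfl | rfl : t = 0 ∨ t = 1 ∨ x = b := hp
            · exact hinr _ _ (by norm_num [clamp_of_nonpos])
            · exact hinr _ _ (by norm_num [clamp_of_one_le])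
            · exact hinr _ _ (by simp [hDb])
          exact (hHp s).trans ((hHp 0).symm.trans (hH₀ p.1 p.2))

end IsMappingCone

/-! ### Independence complexes of induced subgraphs, realized in one Euclidean space -/

section IndepSpace

variable {V : Type} [Fintype V] {G : SimpleGraph V}

/-- The realization of the independence complex of the induced subgraph of `G` on `W`, inside
`ℝ^V`. -/
def indepSpace (G : SimpleGraph V) (W : Set V) : Set (V → ℝ) :=
  {x | (∀ v, 0 ≤ x v) ∧ ∑ v, x v = 1 ∧ (∀ v, x v ≠ 0 → v ∈ W) ∧
    ∀ v w, x v ≠ 0 → x w ≠ 0 → ¬G.Adj v w}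

theorem isCompact_indepSpace (G : SimpleGraph V) (W : Set V) : IsCompact (indepSpace G W) := by
  have h : indepSpace G W = stdSimplex ℝ V ∩ ((⋂ v ∈ Wᶜ, {x | x v = 0}) ∩
      ⋂ (v) (w) (_ : G.Adj v w), {x | x v * x w = 0}) := by
    ext x
    simp only [indepSpace, stdSimplex, Set.mem_inter_iff, Set.mem_ofPred_eq, mul_eq_zero,
      and_assoc, Set.mem_iInter, Set.mem_compl_iff]
    refine and_congr_right fun _ => and_congr_right fun _ => and_congr ?_ ?_
    · exact forall_congr' fun v => not_imp_comm
    · refine forall₂_congr fun v w => ?_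
      tauto
  rw [h]
  refine (isCompact_stdSimplex ℝ V).inter_right (IsClosed.inter ?_ ?_)
  · exact isClosed_iInter fun v => isClosed_iInter fun _ =>
      isClosed_eq (continuous_apply v) continuous_const
  · exact isClosed_iInter fun v => isClosed_iInter fun w => isClosed_iInter fun _ =>
      isClosed_eq (by fun_prop) continuous_const

instance (G : SimpleGraph V) (W : Set V) : CompactSpace (indepSpace G W) :=
  isCompact_iff_compactSpace.1 (isCompact_indepSpace G W)

theorem indepSpace_mono {W W' : Set V} (h : W ⊆ W') : indepSpace G W ⊆ indepSpace G W' :=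
  fun _ hx => ⟨hx.1, hx.2.1, fun v hv => h (hx.2.2.1 v hv), hx.2.2.2⟩

/-- The inclusion of realizations of independence complexes. -/
def indepIncl {W W' : Set V} (h : W ⊆ W') : C(indepSpace G W, indepSpace G W') :=
  ⟨Set.inclusion (indepSpace_mono h), continuous_inclusion _⟩

@[simp]
theorem coe_indepIncl {W W' : Set V} (h : W ⊆ W') (x : indepSpace G W) :
    (indepIncl h x : V → ℝ) = x := rfl

theorem convexComb_mem_indepSpace {W : Set V} {x y : V → ℝ} (hx : x ∈ indepSpace G W)
    (hy : y ∈ indepSpace G W) (h : ∀ v w, x v ≠ 0 → y w ≠ 0 → ¬G.Adj v w) (t : I) :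
    (1 - t : ℝ) • x + (t : ℝ) • y ∈ indepSpace G W := by
  have h₁ : (0 : ℝ) ≤ 1 - t := unitInterval.one_minus_nonneg t
  have hsupp : ∀ v, ((1 - t : ℝ) • x + (t : ℝ) • y) v ≠ 0 → x v ≠ 0 ∨ y v ≠ 0 := fun v hv => by
    by_contra! h
    exact hv (by simp [h.1, h.2])
  refine ⟨fun v => add_nonneg (mul_nonneg h₁ (hx.1 v)) (mul_nonneg t.2.1 (hy.1 v)), ?_,
    fun v hv => (hsupp v hv).elim (hx.2.2.1 v) (hy.2.2.1 v), fun v w hv hw => ?_⟩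
  · simp [Finset.sum_add_distrib, ← Finset.mul_sum, hx.2.1, hy.2.1]
  · rcases hsupp v hv with hv | hv <;> rcases hsupp w hw with hw | hw
    · exact hx.2.2.2 v w hv hw
    · exact h v w hv hw
    · exact fun hvw => h w v hw hv hvw.symm
    · exact hy.2.2.2 v w hv hw

/-- The hypothesis puts `f x` and `g x` in a common simplex, so the straight-line homotopy stays in
the complex. -/
theorem homotopicRel_of_support {T : Type*} [TopologicalSpace T] {W : Set V}
    {f g : C(T, indepSpace G W)} {S : Set T}
    (h : ∀ x v w, (f x : V → ℝ) v ≠ 0 → (g x : V → ℝ) w ≠ 0 → ¬G.Adj v w)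
    (hS : ∀ x ∈ S, f x = g x) : f.HomotopicRel g S := by
  refine homotopicRel_of_pathMap (ContinuousMap.curry
    ⟨fun p : T × I => ⟨_, convexComb_mem_indepSpace (f p.1).2 (g p.1).2 (h p.1) p.2⟩,
      by fun_prop⟩) (fun x => ?_) (fun x => ?_) fun x hx t => ?_
  · ext v; simp
  · ext v; simp
  · ext v
    simp [← hS x hx]
    ring

/-- Near `b` every coordinate that is nonzero at `b` stays nonzero, so a nearby point lies in a
simplex containing `b` and can be moved straight to it. -/
theorem isWellPointed_indepSpace {W : Set V} (b : indepSpace G W) : IsWellPointed b := by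
  obtain ⟨ε, hε, hball⟩ : ∃ ε > 0, ∀ x : indepSpace G W, dist x b < ε →
      ∀ v, (b : V → ℝ) v ≠ 0 → (x : V → ℝ) v ≠ 0 := by
    have hopen : IsOpen {x : indepSpace G W | ∀ v, (b : V → ℝ) v ≠ 0 → (x : V → ℝ) v ≠ 0} := by
      simp only [Set.ofPred_forall]
      refine isOpen_iInter_of_finite fun v => isOpen_iInter_of_finite fun _ => ?_
      exact isOpen_ne_fun ((continuous_apply v).comp continuous_subtype_val) continuous_const
    obtain ⟨ε, hε, h⟩ := Metric.isOpen_iff.1 hopen b fun v hv => hv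
    exact ⟨ε, hε, fun x hx => h hx⟩
  -- The cutoff is `1` up to distance `ε / 2`, where `μ` reaches `1`, and vanishes from distance `ε`
  -- on, where the segment to `b` may leave the complex.
  have hmem : ∀ (x : indepSpace G W) (s : I),
      (1 - ((s * clamp (2 - 2 / ε * dist x b) : I) : ℝ)) • (x : V → ℝ) +
        ((s * clamp (2 - 2 / ε * dist x b) : I) : ℝ) • (b : V → ℝ) ∈ indepSpace G W := by
    intro x s
    by_cases hx : dist x b < ε
    · exact convexComb_mem_indepSpace x.2 b.2
        (fun v w hv hw => x.2.2.2.2 v w hv (hball x hx w hw)) _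
    · rw [clamp_of_nonpos]
      · simp
      · have : 2 / ε * ε ≤ 2 / ε * dist x b := by gcongr; exact not_lt.1 hx
        rw [div_mul_cancel₀ _ hε.ne'] at this
        linarith
  refine ⟨⟨fun x => clamp (2 / ε * dist x b), by fun_prop⟩,
    ContinuousMap.curry ⟨fun p : indepSpace G W × I => ⟨_, hmem p.1 p.2⟩, by fun_prop⟩,
    by simp [clamp_of_nonpos], fun x => ?_, fun s => ?_, fun x => ?_⟩
  · ext v; simp
  · ext v; simp; ring
  · rcases le_total 1 (2 / ε * dist x b) with h | h
    · exact Or.inl (clamp_of_one_le h)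
    · right
      ext v
      simp [clamp_of_one_le (show 1 ≤ 2 - 2 / ε * dist x b by linarith)]

section Vertices

variable [DecidableEq V]

/-- The point of the realization corresponding to a vertex. -/
def indepVertex (G : SimpleGraph V) {W : Set V} {v : V} (hv : v ∈ W) : indepSpace G W :=
  ⟨Pi.single v 1, fun w => by by_cases h : w = v <;> simp [h], by simp,
    fun w hw => by
      obtain rfl : w = v := by
        by_contra h
        exact hw (Pi.single_eq_of_ne h _)
      exact hv,
    fun u w hu hw => by
      have h : ∀ u, (Pi.single v 1 : V → ℝ) u ≠ 0 → u = v := fun u hu => by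
        by_contra h
        exact hu (Pi.single_eq_of_ne h _)
      rw [h u hu, h w hw]
      exact G.irrefl⟩

theorem eq_of_indepVertex_ne_zero {W : Set V} {v w : V} {hv : v ∈ W}
    (h : (indepVertex G hv : V → ℝ) w ≠ 0) : w = v := by
  by_contra hw
  exact h (Pi.single_eq_of_ne hw _)

/-- Adding a vertex cones off its link. -/
theorem isMappingCone_indepSpace {W W' L : Set V} {v : V} (hv : v ∈ W)
    (hW' : ∀ w, w ∈ W' ↔ w ∈ W ∧ w ≠ v) (hL : ∀ w, w ∈ L ↔ w ∈ W ∧ w ≠ v ∧ ¬G.Adj v w)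
    (b : indepSpace G L) (hLW' : L ⊆ W') (hW'W : W' ⊆ W) :
    ∃ c : C(indepSpace G L × I, indepSpace G W),
      IsMappingCone (indepIncl (G := G) hLW') (indepIncl hW'W) c := by
  have hmem : ∀ (x : indepSpace G L) (t : I), (1 - t : ℝ) • (x : V → ℝ) +
      (t : ℝ) • (indepVertex G hv : V → ℝ) ∈ indepSpace G W := fun x t =>
    convexComb_mem_indepSpace (indepSpace_mono (hLW'.trans hW'W) x.2) (indepVertex G hv).2
      (fun u w hu hw => by
        rw [eq_of_indepVertex_ne_zero hw, G.adj_comm]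
        exact ((hL u).1 (x.2.2.2.1 u hu)).2.2) t
  obtain ⟨c, hc⟩ : ∃ c : C(indepSpace G L × I, indepSpace G W), ∀ x t, (c (x, t) : V → ℝ) =
      (1 - t : ℝ) • (x : V → ℝ) + (t : ℝ) • (indepVertex G hv : V → ℝ) :=
    ⟨⟨fun p => ⟨_, hmem p.1 p.2⟩, by fun_prop⟩, fun x t => rfl⟩
  have hLv : ∀ x : indepSpace G L, (x : V → ℝ) v = 0 := fun x => by
    by_contra h
    exact ((hL v).1 (x.2.2.2.1 v h)).2.1 rfl
  have hW'v : ∀ x : indepSpace G W', (x : V → ℝ) v = 0 := fun x => by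
    by_contra h
    exact ((hW' v).1 (x.2.2.2.1 v h)).2 rfl
  have hcv : ∀ x t, (c (x, t) : V → ℝ) v = t := fun x t => by
    simp [hc, hLv, indepVertex]
  have hbase : ∀ x, c (x, 0) = indepIncl hW'W (indepIncl (G := G) hLW' x) := fun x => by
    ext w
    simp [hc]
  have hapex : ∀ x x', c (x, 1) = c (x', 1) := fun x x' => by
    ext w
    simp [hc]
  have hcover : ∀ z, (∃ y, indepIncl (G := G) hW'W y = z) ∨ ∃ p, c p = z := by
    intro z
    by_cases hz₀ : (z : V → ℝ) v = 0
    · refine Or.inl ⟨⟨z, z.2.1, z.2.2.1, fun w hw => (hW' w).2 ⟨z.2.2.2.1 w hw, ?_⟩, z.2.2.2.2⟩, ?_⟩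
      · rintro rfl
        exact hw hz₀
      · ext w; rfl
    right
    have hsum : (z : V → ℝ) v + ∑ w ∈ Finset.univ.erase v, (z : V → ℝ) w = 1 := by
      rw [Finset.add_sum_erase _ _ (Finset.mem_univ v), z.2.2.1]
    have hle : (z : V → ℝ) v ≤ 1 := by
      linarith [Finset.sum_nonneg fun w (_ : w ∈ Finset.univ.erase v) => z.2.1 w]
    by_cases hz₁ : (z : V → ℝ) v = 1
    · refine ⟨(b, 1), ?_⟩
      ext w
      have hzero : ∀ w ≠ v, (z : V → ℝ) w = 0 := fun w hw =>
        (Finset.sum_eq_zero_iff_of_nonneg fun w _ => z.2.1 w).1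
          (by linarith : ∑ w ∈ Finset.univ.erase v, (z : V → ℝ) w = 0) w (by simp [hw])
      rcases eq_or_ne w v with rfl | hw
      · simp [hc, indepVertex, hz₁]
      · simp [hc, indepVertex, hw, hzero]
    have hpos : 0 < 1 - (z : V → ℝ) v := by
      rcases hle.lt_or_eq with h | h
      · linarith
      · exact absurd h hz₁
    refine ⟨(⟨fun w => if w = v then 0 else (z : V → ℝ) w / (1 - (z : V → ℝ) v), fun w => ?_, ?_,
      fun w hw => ?_, fun u w hu hw => ?_⟩, ⟨(z : V → ℝ) v, z.2.1 v, hle⟩), ?_⟩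
    · dsimp only
      split_ifs
      · exact le_rfl
      · exact div_nonneg (z.2.1 w) hpos.le
    · rw [← Finset.add_sum_erase _ _ (Finset.mem_univ v), if_pos rfl, zero_add,
        Finset.sum_congr rfl fun w hw => if_neg (Finset.ne_of_mem_erase hw), ← Finset.sum_div,
        div_eq_one_iff_eq hpos.ne']
      linarith
    · simp only [ne_eq, ite_eq_left_iff, div_eq_zero_iff, not_forall, not_or] at hw
      obtain ⟨hwv, hw, -⟩ := hw
      exact (hL w).2 ⟨z.2.2.2.1 w hw, hwv, z.2.2.2.2 v w hz₀ hw⟩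
    · simp only [ne_eq, ite_eq_left_iff, div_eq_zero_iff, not_forall, not_or] at hu hw
      exact z.2.2.2.2 u w hu.2.1 hw.2.1
    · ext w
      rcases eq_or_ne w v with rfl | hw
      · simp [hc, indepVertex]
      · simp [hc, indepVertex, hw, mul_div_cancel₀ _ hpos.ne']
  refine ⟨c, hbase, hapex, hcover, fun {T} _ α β h₀ h₁ => ?_⟩
  let k : C(indepSpace G W' ⊕ (indepSpace G L × I), indepSpace G W) :=
    ⟨Sum.elim (indepIncl hW'W) c, by fun_prop⟩
  -- A continuous surjection from a compact space to a Hausdorff space is a quotient map, so only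
  -- its fibers need checking.
  have hk : Topology.IsQuotientMap k := by
    refine k.continuous.isClosedMap.isQuotientMap k.continuous fun z => ?_
    rcases hcover z with ⟨y, rfl⟩ | ⟨p, rfl⟩
    exacts [⟨Sum.inl y, rfl⟩, ⟨Sum.inr p, rfl⟩]
  have hjc : ∀ y x t, indepIncl hW'W y = c (x, t) → α y = β (x, t) := by
    intro y x t h
    obtain rfl : t = 0 := by
      have := hcv x t
      rw [← h, coe_indepIncl, hW'v] at this
      exact Subtype.ext this.symm
    rw [hbase] at h
    rw [h₀, Set.inclusion_injective (indepSpace_mono hW'W) h]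
  have hker : ∀ a a', k a = k a' → (⟨Sum.elim α β, by fun_prop⟩ : C(_, T)) a =
      (⟨Sum.elim α β, by fun_prop⟩ : C(_, T)) a' := by
    rintro (y | ⟨x, t⟩) (y' | ⟨x', t'⟩) h
    · exact congrArg α (Set.inclusion_injective (indepSpace_mono hW'W) h)
    · exact hjc _ _ _ h
    · exact (hjc _ _ _ h.symm).symm
    · change c (x, t) = c (x', t') at h
      change β (x, t) = β (x', t')
      obtain rfl : t = t' := by
        ext
        rw [← hcv x t, h, hcv]
      rcases eq_or_ne t 1 with rfl | ht
      · exact h₁ x x'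
      have ht' : (1 - t : ℝ) ≠ 0 := fun h' => ht (Subtype.ext (sub_eq_zero.1 h').symm)
      congr 2
      ext w
      have := congrFun (congrArg Subtype.val h) w
      simp only [hc, Pi.add_apply, Pi.smul_apply, smul_eq_mul, add_left_inj] at this
      exact mul_left_cancel₀ ht' this
  exact ⟨hk.lift _ hker, fun y => DFunLike.congr_fun (hk.lift_comp _ hker) (Sum.inl y),
    fun p => DFunLike.congr_fun (hk.lift_comp _ hker) (Sum.inr p)⟩

open PointedSpace

/-- The splitting move. The point `b` is arbitrary because the link is well-pointed everywhere. -/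
theorem indepSpace_equivalent_wedge {W W' L : Set V} {v : V} (hv : v ∈ W)
    (hW' : ∀ w, w ∈ W' ↔ w ∈ W ∧ w ≠ v) (hL : ∀ w, w ∈ L ↔ w ∈ W ∧ w ≠ v ∧ ¬G.Adj v w)
    (hLW' : L ⊆ W') (hW'W : W' ⊆ W) {y₀ : indepSpace G W'}
    (h : (indepIncl (G := G) hLW').Homotopic (.const _ y₀)) (b : indepSpace G L) :
    (ofPoint (indepIncl hW'W y₀)).Equivalent ((ofPoint y₀).wedge (ofPoint b).suspension) := by
  obtain ⟨c, hc⟩ := isMappingCone_indepSpace hv hW' hL b hLW' hW'W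
  obtain ⟨F, F₀, F₁, -⟩ :=
    (ContinuousMap.homotopicRel_empty.2 h).exists_pathMap
  refine hc.equivalent_wedge_suspension ⟨fun p => F p.1 p.2, by fun_prop⟩ F₀ F₁
    (isWellPointed_indepSpace b)

end Vertices

end IndepSpace

/-! ### Vertex maps, contiguity, folds and suspensions by edges -/

section PushMap

variable {V : Type} [Fintype V] [DecidableEq V] {G : SimpleGraph V} {L W : Set V}

/-- `φ` maps independent subsets of `L` to independent subsets of `W`. -/
def IsIndepMap (G : SimpleGraph V) (L W : Set V) (φ : V → V) : Prop :=
  (∀ v ∈ L, φ v ∈ W) ∧ ∀ v ∈ L, ∀ w ∈ L, ¬G.Adj v w → ¬G.Adj (φ v) (φ w)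

/-- The affine extension of a map of vertices. -/
def pushforward (φ : V → V) (x : V → ℝ) (w : V) : ℝ := ∑ v with φ v = w, x v

theorem exists_of_pushforward_ne_zero {φ : V → V} {x : V → ℝ} {w : V}
    (h : pushforward φ x w ≠ 0) : ∃ v, φ v = w ∧ x v ≠ 0 := by
  obtain ⟨v, hv, hx⟩ := Finset.exists_ne_zero_of_sum_ne_zero h
  exact ⟨v, (Finset.mem_filter.1 hv).2, hx⟩

/-- The map of realizations induced by a map of vertices. -/
def pushMap {φ : V → V} (h : IsIndepMap G L W φ) : C(indepSpace G L, indepSpace G W) where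
  toFun x := ⟨pushforward φ x, fun w => Finset.sum_nonneg fun v _ => x.2.1 v,
    (Finset.sum_fiberwise _ _ _).trans x.2.2.1, fun w hw => by
      obtain ⟨v, rfl, hv⟩ := exists_of_pushforward_ne_zero hw
      exact h.1 v (x.2.2.2.1 v hv), fun w w' hw hw' => by
      obtain ⟨v, rfl, hv⟩ := exists_of_pushforward_ne_zero hw
      obtain ⟨v', rfl, hv'⟩ := exists_of_pushforward_ne_zero hw'
      exact h.2 v (x.2.2.2.1 v hv) v' (x.2.2.2.1 v' hv') (x.2.2.2.2 v v' hv hv')⟩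
  continuous_toFun := by
    refine Continuous.subtype_mk (continuous_pi fun w => ?_) _
    exact continuous_finsetSum _ fun v _ => (continuous_apply v).comp continuous_subtype_val

theorem pushMap_eq_indepIncl {φ : V → V} (h : IsIndepMap G L W φ) (hφ : ∀ v ∈ L, φ v = v)
    (hLW : L ⊆ W) : pushMap h = indepIncl hLW := by
  ext x w
  change ∑ v with φ v = w, (x : V → ℝ) v = (x : V → ℝ) w
  have hx : ∀ v, (x : V → ℝ) v ≠ 0 → φ v = v := fun v hv => hφ v (x.2.2.2.1 v hv)
  rw [Finset.sum_filter, Finset.sum_eq_single w]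
  · by_cases hw : (x : V → ℝ) w = 0
    · simp [hw]
    · simp [hx w hw]
  · intro v _ hvw
    by_cases hv : (x : V → ℝ) v = 0
    · simp [hv]
    · simp [hx v hv, hvw]
  · simp

theorem pushMap_const {p : V} (h : IsIndepMap G L W fun _ => p) (hp : p ∈ W) :
    pushMap h = .const _ (indepVertex G hp) := by
  ext x w
  change ∑ v with p = w, (x : V → ℝ) v = (Pi.single p 1 : V → ℝ) w
  by_cases hw : w = p
  · subst hw
    simp [x.2.2.1]
  · simp [hw, Ne.symm hw]

/-- Contiguous maps are homotopic. -/
theorem pushMap_homotopic {φ ψ : V → V} (hφ : IsIndepMap G L W φ) (hψ : IsIndepMap G L W ψ)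
    (h : ∀ v ∈ L, ∀ w ∈ L, ¬G.Adj v w → ¬G.Adj (φ v) (ψ w)) :
    (pushMap hφ).Homotopic (pushMap hψ) := by
  refine (homotopicRel_of_support (S := ∅) (fun x w w' hw hw' => ?_) (by simp)).homotopic
  obtain ⟨v, rfl, hv⟩ := exists_of_pushforward_ne_zero hw
  obtain ⟨v', rfl, hv'⟩ := exists_of_pushforward_ne_zero hw'
  exact h v (x.2.2.2.1 v hv) v' (x.2.2.2.1 v' hv') (x.2.2.2.2 v v' hv hv')

theorem indepIncl_homotopic_pushMap {φ : V → V} (hLW : L ⊆ W) (hφ : IsIndepMap G L W φ)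
    (h : ∀ v ∈ L, ∀ w ∈ L, ¬G.Adj v w → ¬G.Adj v (φ w)) :
    (indepIncl hLW).Homotopic (pushMap hφ) := by
  have hid : IsIndepMap G L W id := ⟨fun v hv => hLW hv, fun _ _ _ _ h => h⟩
  rw [← pushMap_eq_indepIncl hid (fun _ _ => rfl)]
  exact pushMap_homotopic hid hφ h

/-- A map whose image lies in the link of a vertex is homotopic to the constant map at that
vertex. -/
theorem pushMap_homotopic_const {φ : V → V} (hφ : IsIndepMap G L W φ) {p : V} (hp : p ∈ W)
    (h : ∀ v ∈ L, ¬G.Adj (φ v) p) : (pushMap hφ).Homotopic (.const _ (indepVertex G hp)) := by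
  have hc : IsIndepMap G L W fun _ => p := ⟨fun _ _ => hp, fun _ _ _ _ _ => G.irrefl⟩
  rw [← pushMap_const hc]
  exact pushMap_homotopic hφ hc fun v hv _ _ _ => h v hv

theorem const_indepVertex_homotopic {T : Type*} [TopologicalSpace T] {p q : V} (hp : p ∈ W)
    (hq : q ∈ W) (h : ¬G.Adj p q) : (ContinuousMap.const T (indepVertex G hp)).Homotopic
      (.const _ (indepVertex G hq)) := by
  refine (homotopicRel_of_support (S := ∅) (fun x w w' hw hw' => ?_) (by simp)).homotopic
  rwa [eq_of_indepVertex_ne_zero (hv := hp) hw, eq_of_indepVertex_ne_zero (hv := hq) hw']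

open PointedSpace

/-- A retraction onto `W'` contiguous to the identity gives a deformation retraction. -/
theorem indepSpace_equivalent_of_fold {W' : Set V} (hW'W : W' ⊆ W) {φ : V → V}
    (hφ : IsIndepMap G W W' φ) (hφW' : ∀ v ∈ W', φ v = v)
    (h : ∀ v ∈ W, ∀ w ∈ W, ¬G.Adj v w → ¬G.Adj v (φ w)) (x : indepSpace G W') :
    (ofPoint (indepIncl hW'W x)).Equivalent (ofPoint x) := by
  have hret : (pushMap hφ).comp (indepIncl hW'W) = .id _ := by
    have hres : IsIndepMap G W' W' φ :=
      ⟨fun v hv => hφ.1 v (hW'W hv), fun v hv w hw => hφ.2 v (hW'W hv) w (hW'W hw)⟩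
    exact pushMap_eq_indepIncl hres hφW' subset_rfl
  refine ⟨pushMap hφ, indepIncl hW'W, DFunLike.congr_fun hret x, rfl,
    ContinuousMap.HomotopicRel.symm (homotopicRel_of_support ?_ ?_), ?_⟩
  · intro y v w hv hw
    obtain ⟨w, rfl, hw'⟩ := exists_of_pushforward_ne_zero hw
    exact h v (y.2.2.2.1 v hv) w (y.2.2.2.1 w hw') (y.2.2.2.2 v w hv hw')
  · rintro _ rfl
    exact (congrArg (indepIncl hW'W) (DFunLike.congr_fun hret x)).symm
  · exact hret ▸ .refl _

/-- A connected component that is a single edge suspends the independence complex. -/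
theorem indepSpace_equivalent_suspension {A : Set V} {p q : V} (hpq : G.Adj p q)
    (hp : p ∈ W) (hq : q ∈ W) (hA : ∀ w, w ∈ A ↔ w ∈ W ∧ w ≠ p ∧ w ≠ q)
    (hpA : ∀ w ∈ A, ¬G.Adj p w) (hqA : ∀ w ∈ A, ¬G.Adj q w) (b : indepSpace G A) :
    (ofPoint (indepVertex G hp)).Equivalent (ofPoint b).suspension := by
  have hpW' : p ∈ W \ {q} := ⟨hp, hpq.ne⟩
  have hAW' : A ⊆ W \ {q} := fun w hw => ⟨((hA w).1 hw).1, ((hA w).1 hw).2.2⟩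
  have hcone : ∀ w ∈ W \ {q}, ¬G.Adj w p := fun w hw hadj => by
    by_cases hwp : w = p
    · exact G.irrefl (hwp ▸ hadj)
    · exact hpA w ((hA w).2 ⟨hw.1, hwp, hw.2⟩) hadj.symm
  have hW' : ∀ w, w ∈ A ↔ w ∈ W ∧ w ≠ q ∧ ¬G.Adj q w := fun w => by
    constructor
    · exact fun hw => ⟨((hA w).1 hw).1, ((hA w).1 hw).2.2, hqA w hw⟩
    · rintro ⟨hw, hwq, hadj⟩
      refine (hA w).2 ⟨hw, ?_, hwq⟩
      rintro rfl
      exact hadj hpq.symm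
  have hid : IsIndepMap G A (W \ {q}) id := ⟨fun v hv => hAW' hv, fun _ _ _ _ h => h⟩
  -- Without `q` the complex is a cone with apex `p`. Hence the splitting at `q` has a contractible
  -- first summand, and only the suspension of `I(A)` survives.
  have hnull : (indepIncl (G := G) hAW').Homotopic (.const _ (indepVertex G hpW')) := by
    rw [← pushMap_eq_indepIncl hid fun _ _ => rfl]
    exact pushMap_homotopic_const hid hpW' fun v hv => hcone v (hAW' hv)
  refine (indepSpace_equivalent_wedge hq (fun w => Iff.rfl) hW' hAW' Set.sdiff_subset hnull b).trans
    (Equivalent.wedge_of_contractible _ ?_)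
  refine homotopicRel_of_support (fun x v w hv hw => ?_) ?_
  · rw [eq_of_indepVertex_ne_zero (hv := hpW') hv, G.adj_comm]
    exact hcone w (x.2.2.2.1 w hw)
  · rintro _ rfl
    rfl

/-- Adding `k + 1` disjoint edges suspends the independence complex `k + 1` times. -/
theorem indepSpace_equivalent_iteratedSuspension {m : ℕ} {A : ℕ → Set V} {P Q : Fin m → V}
    (hPQ : ∀ k, G.Adj (P k) (Q k)) (hP : ∀ k : Fin m, P k ∈ A (k + 1))
    (hQ : ∀ k : Fin m, Q k ∈ A (k + 1))
    (hA : ∀ (k : Fin m) w, w ∈ A k ↔ w ∈ A (k + 1) ∧ w ≠ P k ∧ w ≠ Q k)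
    (hPA : ∀ k : Fin m, ∀ w ∈ A k, ¬G.Adj (P k) w)
    (hQA : ∀ k : Fin m, ∀ w ∈ A k, ¬G.Adj (Q k) w) (b : indepSpace G (A 0)) (k : ℕ) (hk : k < m) :
    (ofPoint (indepVertex G (hP ⟨k, hk⟩))).Equivalent (iteratedSuspension (k + 1) (ofPoint b)) := by
  induction k with
  | zero =>
    exact indepSpace_equivalent_suspension (hPQ ⟨0, hk⟩) _ (hQ ⟨0, hk⟩) (hA ⟨0, hk⟩)
      (hPA ⟨0, hk⟩) (hQA ⟨0, hk⟩) b
  | succ k ih =>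
    exact (indepSpace_equivalent_suspension (hPQ ⟨k + 1, hk⟩) _ (hQ ⟨k + 1, hk⟩)
      (hA ⟨k + 1, hk⟩) (hPA ⟨k + 1, hk⟩) (hQA ⟨k + 1, hk⟩)
      (indepVertex G (hP ⟨k, by omega⟩))).trans (ih (by omega)).suspension

end PushMap

/-! ### Comparison with realizations of abstract complexes -/

section Transfer

variable {V V' : Type} [Fintype V] [DecidableEq V] {G : SimpleGraph V} {W : Set V}

/-- A flag complex embedded in an independence complex as an induced subcomplex. -/
theorem exists_homeomorph_indepSpace [Finite V'] (K : AbstractSimplicialComplex V') {ι : V' → V}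
    (hι : Function.Injective ι) (hW : ∀ v, v ∈ W ↔ ∃ u, ι u = v)
    (hK : ∀ s : Finset V', s ∈ K.faces ↔
      s.Nonempty ∧ ∀ u ∈ s, ∀ v ∈ s, ¬G.Adj (ι u) (ι v)) :
    Nonempty (K.realization ≃ₜ indepSpace G W) := by
  classical
  cases nonempty_fintype V'
  let e : (V' → ℝ) → V → ℝ := fun x v => ∑ u with ι u = v, x u
  have he : ∀ x u, e x (ι u) = x u := fun x u => by
    simp [e, Finset.sum_filter, hι.eq_iff]
  have he' : ∀ x v, e x v ≠ 0 → ∃ u, ι u = v ∧ x u ≠ 0 := fun x v h => by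
    obtain ⟨u, hu, hx⟩ := Finset.exists_ne_zero_of_sum_ne_zero h
    exact ⟨u, (Finset.mem_filter.1 hu).2, hx⟩
  have hmem : ∀ x ∈ K.realization, e x ∈ indepSpace G W := by
    rintro x ⟨hx, s, hs, hxs, hsum⟩
    have hsupp : ∀ u, x u ≠ 0 → u ∈ s := fun u hu => by
      by_contra h
      exact hu (hxs u h)
    refine ⟨fun v => Finset.sum_nonneg fun u _ => hx u, ?_, fun v hv => ?_, fun v w hv hw => ?_⟩
    · rw [Finset.sum_fiberwise, ← hsum]
      exact (Finset.sum_subset (Finset.subset_univ s) fun u _ hu => hxs u hu).symm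
    · obtain ⟨u, hu, -⟩ := he' x v hv
      exact (hW v).2 ⟨u, hu⟩
    · obtain ⟨u, rfl, hu⟩ := he' x v hv
      obtain ⟨u', rfl, hu'⟩ := he' x w hw
      exact ((hK s).1 hs).2 u (hsupp u hu) u' (hsupp u' hu')
  have hsumι : ∀ y ∈ indepSpace G W, ∑ u, y (ι u) = 1 := fun y hy => by
    rw [← hy.2.1, ← Finset.sum_image (f := y) (g := ι) fun _ _ _ _ h => hι h]
    refine Finset.sum_subset (Finset.subset_univ _) fun v _ hv => ?_
    by_contra h
    obtain ⟨u, rfl⟩ := (hW v).1 (hy.2.2.1 v h)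
    exact hv (Finset.mem_image_of_mem _ (Finset.mem_univ u))
  have hmem' : ∀ y ∈ indepSpace G W, y ∘ ι ∈ K.realization := by
    intro y hy
    -- The face carrying `y ∘ ι` is taken to be its support.
    have hsum : ∑ u with y (ι u) ≠ 0, y (ι u) = 1 := by
      rw [Finset.sum_filter_ne_zero, hsumι y hy]
    refine ⟨fun u => hy.1 _, Finset.univ.filter fun u => y (ι u) ≠ 0, (hK _).2 ⟨?_, ?_⟩,
      fun u hu => ?_, hsum⟩
    · by_contra h
      rw [Finset.not_nonempty_iff_eq_empty.1 h] at hsum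
      simp at hsum
    · simp only [Finset.mem_filter, Finset.mem_univ, true_and]
      exact fun u hu v hv => hy.2.2.2 _ _ hu hv
    · simpa using hu
  refine ⟨{ toFun := fun x => ⟨e x, hmem x x.2⟩
            invFun := fun y => ⟨y ∘ ι, hmem' y y.2⟩
            left_inv := fun x => by ext u; exact he x u
            right_inv := fun y => by
              ext v
              by_cases hv : ∃ u, ι u = v
              · obtain ⟨u, rfl⟩ := hv
                exact he _ u
              · have h₁ : (y : V → ℝ) v = 0 := by
                  by_contra h
                  exact hv ((hW v).1 (y.2.2.2.1 v h))
                have h₂ : e ((y : V → ℝ) ∘ ι) v = 0 := by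
                  by_contra h
                  obtain ⟨u, hu, -⟩ := he' _ _ h
                  exact hv ⟨u, hu⟩
                exact h₂.trans h₁.symm
            continuous_toFun := ?_
            continuous_invFun := ?_ }⟩
  · refine Continuous.subtype_mk (continuous_pi fun v => ?_) _
    exact continuous_finsetSum _ fun u _ => (continuous_apply u).comp continuous_subtype_val
  · exact Continuous.subtype_mk (continuous_pi fun u =>
      (continuous_apply (A := fun _ : V => ℝ) (ι u)).comp continuous_subtype_val) _

end Transfer

/-! ### Folds and splittings of the graph -/

namespace BraunHough

open PointedSpace

variable {m n : ℕ}

/-- The vertices of `Δ^m_n`. -/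
abbrev Vertex (m n : ℕ) : Type := Fin n ⊕ (Fin (n - 1) × Fin m)

@[simp]
theorem adj_inl_inl (i j : Fin n) : ¬(braunHoughGraph m n).Adj (Sum.inl i) (Sum.inl j) := by
  simp [braunHoughGraph]

@[simp]
theorem adj_inl_inr (i : Fin n) (j : Fin (n - 1)) (k : Fin m) :
    (braunHoughGraph m n).Adj (Sum.inl i) (Sum.inr (j, k)) ↔ (i : ℕ) = j ∨ (i : ℕ) = j + 1 := by
  simp [braunHoughGraph]

@[simp]
theorem adj_inr_inl (i : Fin n) (j : Fin (n - 1)) (k : Fin m) :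
    (braunHoughGraph m n).Adj (Sum.inr (j, k)) (Sum.inl i) ↔ (i : ℕ) = j ∨ (i : ℕ) = j + 1 := by
  rw [SimpleGraph.adj_comm, adj_inl_inr]

@[simp]
theorem adj_inr_inr (i j : Fin (n - 1)) (k l : Fin m) :
    (braunHoughGraph m n).Adj (Sum.inr (i, k)) (Sum.inr (j, l)) ↔
      k = l ∧ ((j : ℕ) = i + 1 ∨ (i : ℕ) = j + 1) := by
  simp only [braunHoughGraph, SimpleGraph.fromRel_adj, ne_eq, Sum.inr.injEq, Prod.mk.injEq,
    not_and, Fin.ext_iff]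
  omega

/-- The vertices `e_i` with `P i` and `f^k_i` with `Q i k`. -/
def vertexSet (m n : ℕ) (P : ℕ → Prop) (Q : ℕ → Fin m → Prop) : Set (Vertex m n) :=
  {v | Sum.elim (fun i : Fin n => P i) (fun p : Fin (n - 1) × Fin m => Q p.1 p.2) v}

@[simp]
theorem inl_mem_vertexSet {P : ℕ → Prop} {Q : ℕ → Fin m → Prop} {i : Fin n} :
    Sum.inl i ∈ vertexSet m n P Q ↔ P i := Iff.rfl

@[simp]
theorem inr_mem_vertexSet {P : ℕ → Prop} {Q : ℕ → Fin m → Prop} {i : Fin (n - 1)} {k : Fin m} :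
    Sum.inr (i, k) ∈ vertexSet m n P Q ↔ Q i k := Iff.rfl

/-- The vertices `e_i` and `f^k_i` with `d ≤ i` (counting from `0`). -/
def tail (m n d : ℕ) : Set (Vertex m n) := vertexSet m n (d ≤ ·) fun i _ => d ≤ i

/-- Suspending along the `m` disjoint edges between `f^k_i` and `f^k_{i+1}`. -/
theorem equivalent_iteratedSuspension_of_edges (d i : ℕ) (hid : i + 2 < d) (hin : i + 2 < n)
    (b : indepSpace (braunHoughGraph (m + 1) n) (tail (m + 1) n d))
    (hp : Sum.inr (⟨i, by omega⟩, Fin.last m) ∈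
      vertexSet (m + 1) n (d ≤ ·) fun j _ => d ≤ j ∨ j = i ∨ j = i + 1) :
    (ofPoint (indepVertex (braunHoughGraph (m + 1) n) hp)).Equivalent
      (iteratedSuspension (m + 1) (ofPoint b)) := by
  -- The strands are added one at a time; passing from `A k` to `A (k + 1)` adds the single isolated
  -- edge of strand `k`.
  let A : ℕ → Set (Vertex (m + 1) n) := fun k =>
    vertexSet (m + 1) n (d ≤ ·) fun j l => d ≤ j ∨ (j = i ∨ j = i + 1) ∧ (l : ℕ) < k
  have hA₀ : tail (m + 1) n d = A 0 := by
    ext (j | ⟨j, l⟩) <;> simp [A, tail]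
  have hA₁ : (vertexSet (m + 1) n (d ≤ ·) fun j _ => d ≤ j ∨ j = i ∨ j = i + 1) = A (m + 1) := by
    ext (j | ⟨j, l⟩)
    · simp [A]
    · simp [A, Nat.le_of_lt_succ l.2]
  revert hp b
  rw [hA₀, hA₁]
  intro b hp
  refine indepSpace_equivalent_iteratedSuspension (A := A)
    (P := fun k => Sum.inr (⟨i, by omega⟩, k)) (Q := fun k => Sum.inr (⟨i + 1, by omega⟩, k))
    ?_ ?_ ?_ ?_ ?_ ?_ b m (by omega)
  · simp
  · simp [A]
  · simp [A]
  · rintro k (j | ⟨j, l⟩)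
    · simp [A]
    · simp [A, Fin.ext_iff]
      omega
  · rintro k (j | ⟨j, l⟩) h
    · simp [A] at h ⊢
      omega
    · simp [A, Fin.ext_iff] at h ⊢
      omega
  · rintro k (j | ⟨j, l⟩) h
    · simp [A] at h ⊢
      omega
    · simp [A, Fin.ext_iff] at h ⊢
      omega

/-- The neighbors of `e_0` are neighbors of `e_1`. -/
theorem fold_e₁ (hn : 5 ≤ n)
    (h : (vertexSet (m + 1) n (fun i => i ≠ 1) fun _ _ => True) ⊆
      (vertexSet (m + 1) n (fun _ => True) fun _ _ => True))
    (x : indepSpace (braunHoughGraph (m + 1) n)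
      (vertexSet (m + 1) n (fun i => i ≠ 1) fun _ _ => True)) :
    (ofPoint (indepIncl h x)).Equivalent (ofPoint x) := by
  refine indepSpace_equivalent_of_fold h (φ := Sum.elim
    (fun i => if (i : ℕ) = 1 then Sum.inl ⟨0, by omega⟩ else Sum.inl i) Sum.inr)
    ⟨?_, ?_⟩ ?_ ?_ x
  · rintro (i | ⟨i, k⟩) hi <;> grind [inl_mem_vertexSet, inr_mem_vertexSet]
  · rintro (i | ⟨i, k⟩) hi (j | ⟨j, l⟩) hj hij <;>
      grind [adj_inl_inl, adj_inl_inr, adj_inr_inl, adj_inr_inr, inl_mem_vertexSet,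
      inr_mem_vertexSet]
  · rintro (i | ⟨i, k⟩) hi <;> grind [inl_mem_vertexSet, inr_mem_vertexSet]
  · rintro (i | ⟨i, k⟩) hi (j | ⟨j, l⟩) hj hij <;>
      grind [adj_inl_inl, adj_inl_inr, adj_inr_inl, adj_inr_inr, inl_mem_vertexSet,
      inr_mem_vertexSet]

/-- Without `e_0`, `e_1` and `e_2`, the neighbors of `f^k_0` are neighbors of `f^k_2`. -/
theorem fold_f₂ (hn : 5 ≤ n)
    (h : (vertexSet (m + 1) n (fun i => 3 ≤ i) fun i _ => 3 ≤ i ∨ i = 0 ∨ i = 1) ⊆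
      (vertexSet (m + 1) n (fun i => 3 ≤ i) fun _ _ => True))
    (x : indepSpace (braunHoughGraph (m + 1) n)
      (vertexSet (m + 1) n (fun i => 3 ≤ i) fun i _ => 3 ≤ i ∨ i = 0 ∨ i = 1)) :
    (ofPoint (indepIncl h x)).Equivalent (ofPoint x) := by
  refine indepSpace_equivalent_of_fold h (φ := Sum.elim Sum.inl
    (fun p => if (p.1 : ℕ) = 2 then Sum.inr (⟨0, by omega⟩, p.2) else Sum.inr p))
    ⟨?_, ?_⟩ ?_ ?_ x
  · rintro (i | ⟨i, k⟩) hi <;> grind [inl_mem_vertexSet, inr_mem_vertexSet]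
  · rintro (i | ⟨i, k⟩) hi (j | ⟨j, l⟩) hj hij <;>
      grind [adj_inl_inl, adj_inl_inr, adj_inr_inl, adj_inr_inr, inl_mem_vertexSet,
      inr_mem_vertexSet]
  · rintro (i | ⟨i, k⟩) hi <;> grind [inl_mem_vertexSet, inr_mem_vertexSet]
  · rintro (i | ⟨i, k⟩) hi (j | ⟨j, l⟩) hj hij <;>
      grind [adj_inl_inl, adj_inl_inr, adj_inr_inl, adj_inr_inr, inl_mem_vertexSet,
      inr_mem_vertexSet]

/-- In the link of `e_2`, the vertices `f^k_0` have the same neighbors. -/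
theorem fold_f₀
    (h : (vertexSet (m + 1) n (fun i => 3 ≤ i ∨ i = 0) fun i k => 3 ≤ i ∨ i = 0 ∧ k = 0) ⊆
      (vertexSet (m + 1) n (fun i => i ≠ 1 ∧ i ≠ 2) fun i _ => i ≠ 1 ∧ i ≠ 2))
    (x : indepSpace (braunHoughGraph (m + 1) n)
      (vertexSet (m + 1) n (fun i => 3 ≤ i ∨ i = 0) fun i k => 3 ≤ i ∨ i = 0 ∧ k = 0)) :
    (ofPoint (indepIncl h x)).Equivalent (ofPoint x) := by
  refine indepSpace_equivalent_of_fold h (φ := Sum.elim Sum.inl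
    (fun p => if (p.1 : ℕ) = 0 then Sum.inr (p.1, 0) else Sum.inr p))
    ⟨?_, ?_⟩ ?_ ?_ x
  · rintro (i | ⟨i, k⟩) hi <;> grind [inl_mem_vertexSet, inr_mem_vertexSet]
  · rintro (i | ⟨i, k⟩) hi (j | ⟨j, l⟩) hj hij <;>
      grind [adj_inl_inl, adj_inl_inr, adj_inr_inl, adj_inr_inr, inl_mem_vertexSet,
      inr_mem_vertexSet]
  · rintro (i | ⟨i, k⟩) hi <;> grind [inl_mem_vertexSet, inr_mem_vertexSet]
  · rintro (i | ⟨i, k⟩) hi (j | ⟨j, l⟩) hj hij <;>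
      grind [adj_inl_inl, adj_inl_inr, adj_inr_inl, adj_inr_inr, inl_mem_vertexSet,
      inr_mem_vertexSet]

/-- In the link of `e_0`, the neighbors of `f^k_1` are neighbors of `f^k_3` and of `e_3`. -/
theorem fold_e₃_f₃ (hn : 5 ≤ n)
    (h : (vertexSet (m + 1) n (fun i => 4 ≤ i) fun i _ => 4 ≤ i ∨ i = 1 ∨ i = 2) ⊆
      (vertexSet (m + 1) n (fun i => 3 ≤ i) fun i _ => 1 ≤ i))
    (x : indepSpace (braunHoughGraph (m + 1) n)
      (vertexSet (m + 1) n (fun i => 4 ≤ i) fun i _ => 4 ≤ i ∨ i = 1 ∨ i = 2)) :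
    (ofPoint (indepIncl h x)).Equivalent (ofPoint x) := by
  refine indepSpace_equivalent_of_fold h (φ := Sum.elim
    (fun i => if (i : ℕ) = 3 then Sum.inr (⟨1, by omega⟩, 0) else Sum.inl i)
    (fun p => if (p.1 : ℕ) = 3 then Sum.inr (⟨1, by omega⟩, p.2) else Sum.inr p))
    ⟨?_, ?_⟩ ?_ ?_ x
  · rintro (i | ⟨i, k⟩) hi <;> grind [inl_mem_vertexSet, inr_mem_vertexSet]
  · rintro (i | ⟨i, k⟩) hi (j | ⟨j, l⟩) hj hij <;>
      grind [adj_inl_inl, adj_inl_inr, adj_inr_inl, adj_inr_inr, inl_mem_vertexSet,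
      inr_mem_vertexSet]
  · rintro (i | ⟨i, k⟩) hi <;> grind [inl_mem_vertexSet, inr_mem_vertexSet]
  · rintro (i | ⟨i, k⟩) hi (j | ⟨j, l⟩) hj hij <;>
      grind [adj_inl_inl, adj_inl_inr, adj_inr_inl, adj_inr_inr, inl_mem_vertexSet,
      inr_mem_vertexSet]

/-- The link of `e_2` can be moved into the link of any `f^q_0` with `q ≠ 0`. -/
theorem link_e₂_nullhomotopic (hn : 5 ≤ n) {q : Fin (m + 1)} (hq : q ≠ 0)
    (h : (vertexSet (m + 1) n (fun i => i ≠ 1 ∧ i ≠ 2) fun i _ => i ≠ 1 ∧ i ≠ 2) ⊆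
      (vertexSet (m + 1) n (fun i => i ≠ 1 ∧ i ≠ 2) fun _ _ => True))
    (hp : Sum.inr (⟨0, by omega⟩, q) ∈ (vertexSet (m + 1) n (fun i => i ≠ 1 ∧ i ≠ 2) fun _ _ => True)) :
    (indepIncl (G := braunHoughGraph (m + 1) n) h).Homotopic
      (.const _ (indepVertex (braunHoughGraph (m + 1) n) hp)) := by
  -- The neighbors of `f^q_0` are `e_0`, `e_1` and `f^q_1`. Sending `e_0` to `f^0_1` and every
  -- `f^k_0` to `f^0_0` avoids all of them, since `q ≠ 0`.
  have hφ : IsIndepMap (braunHoughGraph (m + 1) n)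
      (vertexSet (m + 1) n (fun i => i ≠ 1 ∧ i ≠ 2) fun i _ => i ≠ 1 ∧ i ≠ 2)
      (vertexSet (m + 1) n (fun i => i ≠ 1 ∧ i ≠ 2) fun _ _ => True) (Sum.elim
      (fun i => if (i : ℕ) = 0 then Sum.inr (⟨1, by omega⟩, 0) else Sum.inl i)
      (fun p => if (p.1 : ℕ) = 0 then Sum.inr (p.1, 0) else Sum.inr p)) := by
    refine ⟨?_, ?_⟩
    · rintro (i | ⟨i, k⟩) hi
      · dsimp only [Sum.elim_inl]
        split_ifs
        exacts [trivial, hi]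
      · dsimp only [Sum.elim_inr]
        split_ifs <;> trivial
    · rintro (i | ⟨i, k⟩) hi (j | ⟨j, l⟩) hj hij <;>
      grind [adj_inl_inl, adj_inl_inr, adj_inr_inl, adj_inr_inr, inl_mem_vertexSet,
      inr_mem_vertexSet]
  refine (indepIncl_homotopic_pushMap h hφ ?_).trans (pushMap_homotopic_const hφ hp ?_)
  · rintro (i | ⟨i, k⟩) hi (j | ⟨j, l⟩) hj hij <;>
      grind [adj_inl_inl, adj_inl_inr, adj_inr_inl, adj_inr_inr, inl_mem_vertexSet,
      inr_mem_vertexSet]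
  · rintro (i | ⟨i, k⟩) hi <;> grind [adj_inl_inl, adj_inl_inr, adj_inr_inl, adj_inr_inr, inl_mem_vertexSet,
      inr_mem_vertexSet]

/-- The link of `e_0` can be moved into the link of `e_3`. -/
theorem link_e₀_nullhomotopic (hn : 5 ≤ n) {q : Fin (m + 1)}
    (h : (vertexSet (m + 1) n (fun i => 3 ≤ i) fun i _ => 1 ≤ i) ⊆
      (vertexSet (m + 1) n (fun i => 3 ≤ i) fun _ _ => True))
    (hp : Sum.inr (⟨0, by omega⟩, q) ∈ (vertexSet (m + 1) n (fun i => 3 ≤ i) fun _ _ => True)) :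
    (indepIncl (G := braunHoughGraph (m + 1) n) h).Homotopic
      (.const _ (indepVertex (braunHoughGraph (m + 1) n) hp)) := by
  -- The neighbors of `e_3` are the `f^k_2` and `f^k_3`; they move two steps down their strands. The
  -- vertex `e_3` must move too, since `f^k_1` is compatible with neither of the moved options
  -- `f^k_0` nor `f^k_2` beyond what `f^k_3` allows; `f^0_1` keeps independent sets independent.
  have hφ : IsIndepMap (braunHoughGraph (m + 1) n)
      (vertexSet (m + 1) n (fun i => 3 ≤ i) fun i _ => 1 ≤ i)
      (vertexSet (m + 1) n (fun i => 3 ≤ i) fun _ _ => True) (Sum.elim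
      (fun i => if (i : ℕ) = 3 then Sum.inr (⟨1, by omega⟩, 0) else Sum.inl i)
      (fun p => if (p.1 : ℕ) = 2 then Sum.inr (⟨0, by omega⟩, p.2) else
        if (p.1 : ℕ) = 3 then Sum.inr (⟨1, by omega⟩, p.2) else Sum.inr p)) := by
    refine ⟨?_, ?_⟩
    · rintro (i | ⟨i, k⟩) hi <;> grind [inl_mem_vertexSet, inr_mem_vertexSet]
    · rintro (i | ⟨i, k⟩) hi (j | ⟨j, l⟩) hj hij <;>
      grind [adj_inl_inl, adj_inl_inr, adj_inr_inl, adj_inr_inr, inl_mem_vertexSet,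
      inr_mem_vertexSet]
  have he₃ : Sum.inl ⟨3, by omega⟩ ∈ (vertexSet (m + 1) n (fun i => 3 ≤ i) fun _ _ => True) := by
    simp
  -- The null-homotopy ends at `e_3`; one more edge carries it to `f^q_0`, the base point used in
  -- the other splitting.
  refine ((indepIncl_homotopic_pushMap h hφ ?_).trans (pushMap_homotopic_const hφ he₃ ?_)).trans
    (const_indepVertex_homotopic he₃ hp (by simp))
  · rintro (i | ⟨i, k⟩) hi (j | ⟨j, l⟩) hj hij <;>
      grind [adj_inl_inl, adj_inl_inr, adj_inr_inl, adj_inr_inr, inl_mem_vertexSet,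
      inr_mem_vertexSet]
  · rintro (i | ⟨i, k⟩) hi <;> grind [adj_inl_inl, adj_inl_inr, adj_inr_inl, adj_inr_inr, inl_mem_vertexSet,
      inr_mem_vertexSet]

/-- There are `m + 1` strands here, so `1 ≤ m` provides the second strand. Both splittings and the
summand `hb` use the vertex `f_0` of the last strand as base point, which makes the pointed
equivalences composable. -/
theorem exists_equivalent_wedge (hm : 1 ≤ m) (hn : 5 ≤ n)
    (a b : indepSpace (braunHoughGraph (m + 1) n) (tail (m + 1) n 3))
    (c : indepSpace (braunHoughGraph (m + 1) n) (tail (m + 1) n 4)) :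
    ∃ x : indepSpace (braunHoughGraph (m + 1) n) (vertexSet (m + 1) n (fun _ => True) fun _ _ => True),
      (ofPoint x).Equivalent (((iteratedSuspension 2 (ofPoint a)).wedge
        (iteratedSuspension (m + 1) (ofPoint b))).wedge
          (iteratedSuspension (m + 2) (ofPoint c))) := by
  let G := braunHoughGraph (m + 1) n
  let p : Vertex (m + 1) n := Sum.inr (⟨0, by omega⟩, Fin.last m)
  let p₁ : Vertex (m + 1) n := Sum.inr (⟨1, by omega⟩, Fin.last m)
  let e₀ : Vertex (m + 1) n := Sum.inl ⟨0, by omega⟩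
  have hp : ∀ P Q, Q 0 (Fin.last m) → p ∈ vertexSet (m + 1) n P Q := fun P Q h => h
  have hp₁ : ∀ P Q, Q 1 (Fin.last m) → p₁ ∈ vertexSet (m + 1) n P Q := fun P Q h => h
  have he₀ : ∀ P Q, P 0 → e₀ ∈ vertexSet (m + 1) n P Q := fun P Q h => h
  have hsub : ∀ P P' Q Q', (∀ i, P i → P' i) → (∀ i k, Q i k → Q' i k) →
      vertexSet (m + 1) n P Q ⊆ vertexSet (m + 1) n P' Q' := by
    rintro P P' Q Q' hP hQ (i | ⟨i, k⟩) h
    exacts [hP i h, hQ i k h]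
  -- the three summands
  have ha : (ofPoint (indepVertex G (W := (vertexSet (m + 1) n (fun i => i ≠ 1 ∧ i ≠ 2) fun i _ => i ≠ 1 ∧ i ≠ 2))
      (he₀ _ _ (by simp)))).Equivalent (ofPoint a).suspension := by
    refine (fold_f₀ (hsub _ _ _ _ (by grind) (by grind))
      (indepVertex G (he₀ _ _ (by simp)))).trans ?_
    -- After the fold, the star has become the single edge from `e_0` to `f^0_0`, isolated from the
    -- tail.
    refine indepSpace_equivalent_suspension (q := Sum.inr (⟨0, by omega⟩, 0)) (by simp [e₀]) _
      (by simp) ?_ ?_ ?_ a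
    · rintro (i | ⟨i, k⟩) <;> grind [tail, adj_inl_inl, adj_inl_inr, adj_inr_inl, adj_inr_inr, inl_mem_vertexSet,
      inr_mem_vertexSet]
    · rintro (i | ⟨i, k⟩) hi <;> grind [tail, adj_inl_inl, adj_inl_inr, adj_inr_inl, adj_inr_inr, inl_mem_vertexSet,
      inr_mem_vertexSet]
    · rintro (i | ⟨i, k⟩) hi <;> grind [tail, adj_inl_inl, adj_inl_inr, adj_inr_inl, adj_inr_inr, inl_mem_vertexSet,
      inr_mem_vertexSet]
  have hb : (ofPoint (indepVertex G (W := (vertexSet (m + 1) n (fun i => 3 ≤ i) fun _ _ => True))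
      (hp _ _ trivial))).Equivalent (iteratedSuspension (m + 1) (ofPoint b)) :=
    (fold_f₂ hn (hsub _ _ _ _ (by grind) (by grind)) (indepVertex G
      (hp _ _ (by simp)))).trans
      (equivalent_iteratedSuspension_of_edges 3 0 (by omega) (by omega) b _)
  have hc : (ofPoint (indepVertex G (W := (vertexSet (m + 1) n (fun i => 3 ≤ i) fun i _ => 1 ≤ i))
      (hp₁ _ _ le_rfl))).Equivalent (iteratedSuspension (m + 1) (ofPoint c)) :=
    (fold_e₃_f₃ hn (hsub _ _ _ _ (by grind) (by grind)) (indepVertex G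
      (hp₁ _ _ (by simp)))).trans
      (equivalent_iteratedSuspension_of_edges 4 1 (by omega) (by omega) c _)
  -- the two splittings
  have h₁ := indepSpace_equivalent_wedge (G := G) (v := Sum.inl ⟨2, by omega⟩)
    (W := (vertexSet (m + 1) n (fun i => i ≠ 1) fun _ _ => True))
    (W' := (vertexSet (m + 1) n (fun i => i ≠ 1 ∧ i ≠ 2) fun _ _ => True))
    (L := (vertexSet (m + 1) n (fun i => i ≠ 1 ∧ i ≠ 2) fun i _ => i ≠ 1 ∧ i ≠ 2)) (by simp)
    (by rintro (i | ⟨i, k⟩) <;> grind [adj_inl_inl, adj_inl_inr, adj_inr_inl, adj_inr_inr, inl_mem_vertexSet,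
      inr_mem_vertexSet])
    (by rintro (i | ⟨i, k⟩) <;> grind [adj_inl_inl, adj_inl_inr, adj_inr_inl, adj_inr_inr, inl_mem_vertexSet,
      inr_mem_vertexSet])
    (hsub _ _ _ _ (by grind) (by grind)) (hsub _ _ _ _ (by grind) (by grind))
    (link_e₂_nullhomotopic hn (mt Fin.last_eq_zero_iff.1 (by omega)) _ (hp _ _ trivial))
    (indepVertex G (he₀ _ _ (by simp)))
  have h₂ := indepSpace_equivalent_wedge (G := G) (v := e₀)
    (W := (vertexSet (m + 1) n (fun i => i ≠ 1 ∧ i ≠ 2) fun _ _ => True))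
    (W' := (vertexSet (m + 1) n (fun i => 3 ≤ i) fun _ _ => True))
    (L := (vertexSet (m + 1) n (fun i => 3 ≤ i) fun i _ => 1 ≤ i)) (by simp [e₀])
    (by rintro (i | ⟨i, k⟩) <;> grind [adj_inl_inl, adj_inl_inr, adj_inr_inl, adj_inr_inr, inl_mem_vertexSet,
      inr_mem_vertexSet])
    (by rintro (i | ⟨i, k⟩) <;> grind [adj_inl_inl, adj_inl_inr, adj_inr_inl, adj_inr_inr, inl_mem_vertexSet,
      inr_mem_vertexSet])
    (hsub _ _ _ _ (by grind) (by grind)) (hsub _ _ _ _ (by grind) (by grind))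
    (link_e₀_nullhomotopic hn _ (hp _ _ trivial))
    (indepVertex G (hp₁ _ _ le_rfl))
  have h₀ := fold_e₁ hn (hsub _ _ _ _ (by grind) (by grind))
    (indepVertex G (hp _ _ trivial))
  refine ⟨_, h₀.trans <| h₁.trans <| Equivalent.trans (.wedge (h₂.trans
    (.wedge hb hc.suspension)) ha.suspension) ?_⟩
  exact (Equivalent.wedge_comm _ _).trans (Equivalent.wedge_assoc _ _ _)

end BraunHough

/-! ### Shifted copies of the graph, and the grid as the case of two strands -/

namespace BraunHough

open PointedSpace

variable {m n : ℕ}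

/-- A complex isomorphic to `I(Δ^m_{n-d})` is realized by the last vertices of `Δ^m_n`. -/
theorem nonempty_homeomorph_tail {V : Type} [Finite V] (K : AbstractSimplicialComplex V) (d : ℕ)
    (e : V ≃ Vertex m (n - d))
    (hK : ∀ s : Finset V, s ∈ K.faces ↔
      s.Nonempty ∧ ∀ u ∈ s, ∀ v ∈ s, ¬(braunHoughGraph m (n - d)).Adj (e u) (e v)) :
    Nonempty (K.realization ≃ₜ indepSpace (braunHoughGraph m n) (tail m n d)) := by
  let φ : Vertex m (n - d) → Vertex m n := Sum.elim (fun i => Sum.inl ⟨i + d, by omega⟩)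
    fun p => Sum.inr (⟨p.1 + d, by omega⟩, p.2)
  refine exists_homeomorph_indepSpace K (ι := φ ∘ e) (Function.Injective.comp ?_ e.injective) ?_ ?_
  · rintro (i | ⟨i, k⟩) (j | ⟨j, l⟩) h
    · simpa [φ, Fin.ext_iff] using h
    · simp [φ] at h
    · simp [φ] at h
    · simpa [φ, Fin.ext_iff] using h
  · intro v
    rw [show (∃ u, (φ ∘ e) u = v) ↔ ∃ u, φ u = v from
      (e.surjective.exists (p := fun u => φ u = v)).symm]
    rcases v with i | ⟨i, k⟩
    · constructor
      · intro (h : d ≤ (i : ℕ))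
        exact ⟨Sum.inl ⟨i - d, by omega⟩, by simp [φ, Fin.ext_iff]; omega⟩
      · rintro ⟨j | ⟨j, l⟩, h⟩
        · simp [φ, Fin.ext_iff] at h
          exact (Nat.le_add_left d j).trans h.le
        · simp [φ] at h
    · constructor
      · intro (h : d ≤ (i : ℕ))
        exact ⟨Sum.inr (⟨i - d, by omega⟩, k), by simp [φ, Fin.ext_iff]; omega⟩
      · rintro ⟨j | ⟨j, l⟩, h⟩
        · simp [φ] at h
        · simp [φ, Fin.ext_iff] at h
          exact (Nat.le_add_left d j).trans h.1.le
  · have hφ : ∀ u v, (braunHoughGraph m n).Adj (φ u) (φ v) ↔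
        (braunHoughGraph m (n - d)).Adj u v := by
      rintro (i | ⟨i, k⟩) (j | ⟨j, l⟩) <;> simp [φ] <;> omega
    simpa only [Function.comp_apply, hφ] using hK

theorem mem_faces_independenceComplex {V : Type*} {G : SimpleGraph V} {s : Finset V} :
    s ∈ (independenceComplex G).faces ↔ s.Nonempty ∧ ∀ u ∈ s, ∀ v ∈ s, ¬G.Adj u v := by
  refine and_congr_right fun _ => ⟨fun h u hu v hv huv => h hu hv huv.ne huv,
    fun h u hu v hv _ => h u hu v hv⟩

/-- The edge of the grid `Γ_n` corresponding to a vertex of `Δ^2_n`. -/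
def gridEdge (n : ℕ) : Vertex 2 n → Sym2 (Fin n × Fin 2) :=
  Sum.elim (fun i => s((i, 0), (i, 1)))
    fun p => s((⟨p.1, by omega⟩, p.2), (⟨p.1 + 1, by omega⟩, p.2))

theorem gridEdge_mem (v : Vertex 2 n) : gridEdge n v ∈ (gridGraph n 2).edgeSet := by
  rcases v with i | ⟨i, k⟩ <;> simp [gridEdge, gridGraph]

theorem mem_gridEdge_inl {i : Fin n} {x : Fin n × Fin 2} :
    x ∈ gridEdge n (Sum.inl i) ↔ x.1 = i := by
  obtain ⟨j, l⟩ := x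
  fin_cases l <;> simp [gridEdge]

theorem mem_gridEdge_inr {i : Fin (n - 1)} {k : Fin 2} {x : Fin n × Fin 2} :
    x ∈ gridEdge n (Sum.inr (i, k)) ↔ x.2 = k ∧ ((x.1 : ℕ) = i ∨ (x.1 : ℕ) = i + 1) := by
  obtain ⟨j, l⟩ := x
  simp [gridEdge, Fin.ext_iff]
  omega

theorem gridEdge_injective : Function.Injective (gridEdge n) := by
  have hmem : ∀ {v w x}, gridEdge n v = gridEdge n w → x ∈ gridEdge n v → x ∈ gridEdge n w :=
    fun h hx => h ▸ hx
  have hinl : ∀ (i : Fin n) (j : Fin (n - 1)) (l : Fin 2),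
      gridEdge n (Sum.inl i) ≠ gridEdge n (Sum.inr (j, l)) := fun i j l h => by
    have h₀ := mem_gridEdge_inr.1 (hmem (x := (i, 0)) h (mem_gridEdge_inl.2 rfl))
    have h₁ := mem_gridEdge_inr.1 (hmem (x := (i, 1)) h (mem_gridEdge_inl.2 rfl))
    exact absurd (h₀.1.trans h₁.1.symm) Fin.zero_ne_one
  rintro (i | ⟨i, k⟩) (j | ⟨j, l⟩) h
  · exact congrArg Sum.inl (mem_gridEdge_inl.1 (hmem (x := (i, 0)) h (mem_gridEdge_inl.2 rfl)))
  · exact absurd h (hinl i j l)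
  · exact absurd h.symm (hinl j i k)
  · have h₀ := mem_gridEdge_inr.1 (hmem (x := (⟨i, by omega⟩, k)) h
      (mem_gridEdge_inr.2 ⟨rfl, Or.inl rfl⟩))
    have h₁ := mem_gridEdge_inr.1 (hmem (x := (⟨i + 1, by omega⟩, k)) h
      (mem_gridEdge_inr.2 ⟨rfl, Or.inr rfl⟩))
    simp only [Sum.inr.injEq, Prod.mk.injEq, Fin.ext_iff] at h₀ h₁ ⊢
    omega

theorem exists_gridEdge {e : Sym2 (Fin n × Fin 2)} (he : e ∈ (gridGraph n 2).edgeSet) :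
    ∃ v, gridEdge n v = e := by
  induction e with | _ p q
  have hne : p ≠ q := (SimpleGraph.mem_edgeSet _).1 he |>.ne
  have key : ∀ v, p ∈ gridEdge n v → q ∈ gridEdge n v → ∃ v, gridEdge n v = s(p, q) :=
    fun v hp hq => ⟨v, (Sym2.mem_and_mem_iff hne).1 ⟨hp, hq⟩⟩
  obtain ⟨i, k⟩ := p
  obtain ⟨j, l⟩ := q
  replace he : |((j : ℕ) : ℤ) - ((i : ℕ) : ℤ)| + |((l : ℕ) : ℤ) - ((k : ℕ) : ℤ)| = 1 := he
  by_cases hij : i = j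
  · exact key (Sum.inl i) (mem_gridEdge_inl.2 rfl) (mem_gridEdge_inl.2 hij.symm)
  have hij' : (i : ℕ) ≠ j := fun h => hij (Fin.ext h)
  have hkl : (k : ℕ) = l ∧ ((j : ℕ) = i + 1 ∨ (i : ℕ) = j + 1) := by
    rcases abs_cases (((j : ℕ) : ℤ) - ((i : ℕ) : ℤ)) with ⟨h₁, h₁'⟩ | ⟨h₁, h₁'⟩ <;>
      rcases abs_cases (((l : ℕ) : ℤ) - ((k : ℕ) : ℤ)) with ⟨h₂, h₂'⟩ | ⟨h₂, h₂'⟩ <;>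
        rw [h₁, h₂] at he <;> omega
  obtain ⟨hkl, h | h⟩ := hkl
  · exact key (Sum.inr (⟨i, by omega⟩, k)) (mem_gridEdge_inr.2 ⟨rfl, Or.inl rfl⟩)
      (mem_gridEdge_inr.2 ⟨Fin.ext hkl.symm, Or.inr h⟩)
  · exact key (Sum.inr (⟨j, by omega⟩, k)) (mem_gridEdge_inr.2 ⟨rfl, Or.inr h⟩)
      (mem_gridEdge_inr.2 ⟨Fin.ext hkl.symm, Or.inl rfl⟩)

/-- The line graph property: rungs correspond to the `e_i` and horizontal edges to the `f^k_i`, so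
matchings of the grid are independent sets of `Δ^2_n`. -/
theorem adj_iff_gridEdge {v w : Vertex 2 n} : (braunHoughGraph 2 n).Adj v w ↔
    gridEdge n v ≠ gridEdge n w ∧ ∃ x, x ∈ gridEdge n v ∧ x ∈ gridEdge n w := by
  rw [gridEdge_injective.ne_iff]
  rcases v with i | ⟨i, k⟩ <;> rcases w with j | ⟨j, l⟩ <;>
    simp only [mem_gridEdge_inl, mem_gridEdge_inr, adj_inl_inl, adj_inl_inr, adj_inr_inl,
      adj_inr_inr, ne_eq, Sum.inl.injEq, Sum.inr.injEq, Prod.mk.injEq, Prod.exists, reduceCtorEq,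
      not_false_eq_true, true_and, false_iff, not_and, not_exists]
  · exact fun h x _ hx hx' => h (hx.symm.trans hx')
  · exact ⟨fun h => ⟨i, l, rfl, rfl, h⟩, by rintro ⟨x, y, rfl, -, h⟩; exact h⟩
  · exact ⟨fun h => ⟨j, k, ⟨rfl, h⟩, rfl⟩, by rintro ⟨x, y, ⟨-, h⟩, rfl⟩; exact h⟩
  · constructor
    · rintro ⟨rfl, h | h⟩
      · exact ⟨fun hij => by omega, ⟨j, by omega⟩, k, ⟨rfl, Or.inr h⟩, rfl, Or.inl rfl⟩
      · exact ⟨fun hij => by omega, ⟨i, by omega⟩, k, ⟨rfl, Or.inl rfl⟩, rfl, Or.inr h⟩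
    · rintro ⟨hne, x, y, ⟨rfl, h⟩, rfl, h'⟩
      have hij : (i : ℕ) ≠ j := fun hij => hne (Fin.ext hij) rfl
      exact ⟨rfl, by omega⟩

/-- The graph `Δ^2_n` is the line graph of the grid. -/
noncomputable def edgeEquiv (n : ℕ) : (gridGraph n 2).edgeSet ≃ Vertex 2 n :=
  (Equiv.ofBijective (fun v => ⟨gridEdge n v, gridEdge_mem v⟩)
    ⟨fun _ _ h => gridEdge_injective (congrArg Subtype.val h),
      fun e => (exists_gridEdge e.2).imp fun _ h => Subtype.ext h⟩).symm

theorem gridEdge_edgeEquiv (e : (gridGraph n 2).edgeSet) : gridEdge n (edgeEquiv n e) = e :=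
  congrArg Subtype.val ((edgeEquiv n).symm_apply_apply e)

theorem mem_faces_matchingComplex {s : Finset (gridGraph n 2).edgeSet} :
    s ∈ (matchingComplex (gridGraph n 2)).faces ↔
      s.Nonempty ∧ ∀ e ∈ s, ∀ e' ∈ s,
        ¬(braunHoughGraph 2 n).Adj (edgeEquiv n e) (edgeEquiv n e') := by
  refine and_congr_right fun _ => ?_
  simp only [adj_iff_gridEdge, gridEdge_edgeEquiv, not_and, not_exists, ne_eq, Subtype.coe_inj]
  refine ⟨fun h e he e' he' hne x hx hx' => hne (h x e he e' he' hx hx'),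
    fun h x e he e' he' hx hx' => ?_⟩
  by_contra hne
  exact h e he e' he' hne x hx hx'

/-- Stated for arbitrary spaces homeomorphic to the tails, so that it serves independence complexes
and matching complexes alike. -/
theorem nonempty_homotopyEquiv (hm : 2 ≤ m) (hn : 5 ≤ n) {R₀ R₃ R₄ : Type} [TopologicalSpace R₀]
    [TopologicalSpace R₃] [TopologicalSpace R₄]
    (e₀ : Nonempty (R₀ ≃ₜ indepSpace (braunHoughGraph m n) (tail m n 0)))
    (e₃ : Nonempty (R₃ ≃ₜ indepSpace (braunHoughGraph m n) (tail m n 3)))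
    (e₄ : Nonempty (R₄ ≃ₜ indepSpace (braunHoughGraph m n) (tail m n 4))) (a b : R₃) (c : R₄) :
    Nonempty (R₀ ≃ₕ (((iteratedSuspension 2 (ofPoint a)).wedge
      (iteratedSuspension m (ofPoint b))).wedge
        (iteratedSuspension (m + 1) (ofPoint c))).carrier) := by
  obtain ⟨m, rfl⟩ : ∃ k, m = k + 1 := ⟨m - 1, by omega⟩
  obtain ⟨e₀⟩ := e₀
  obtain ⟨e₃⟩ := e₃
  obtain ⟨e₄⟩ := e₄
  have hR₃ : ∀ x, (ofPoint (e₃ x)).Equivalent (ofPoint x) := fun x =>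
    (Equivalent.of_homeomorph (X := ofPoint x) (Y := ofPoint (e₃ x)) e₃ rfl).symm
  have hR₄ : (ofPoint (e₄ c)).Equivalent (ofPoint c) :=
    (Equivalent.of_homeomorph (X := ofPoint c) (Y := ofPoint (e₄ c)) e₄ rfl).symm
  obtain ⟨x, hx⟩ := exists_equivalent_wedge (by omega) hn (e₃ a) (e₃ b) (e₄ c)
  have htail : tail (m + 1) n 0 = vertexSet (m + 1) n (fun _ => True) fun _ _ => True := by
    ext (i | ⟨i, k⟩) <;> simp [tail]
  rw [htail] at e₀
  obtain ⟨h⟩ := (hx.trans (.wedge (.wedge (.iteratedSuspension (hR₃ a) _)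
    (.iteratedSuspension (hR₃ b) _)) (.iteratedSuspension hR₄ _))).homotopyEquiv
  exact ⟨e₀.toHomotopyEquiv.trans h⟩

end BraunHough

open BraunHough

theorem theorem1p1 (n : ℕ) (hn : 5 ≤ n) :
    (∀ m : ℕ, 2 ≤ m →
      ∀ (a b : (independenceComplex (braunHoughGraph m (n - 3))).realization)
        (c : (independenceComplex (braunHoughGraph m (n - 4))).realization),
        Nonempty ((independenceComplex (braunHoughGraph m n)).realization ≃ₕ
          (((PointedSpace.iteratedSuspension 2 (PointedSpace.ofPoint a)).wedge
            (PointedSpace.iteratedSuspension m (PointedSpace.ofPoint b))).wedge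
            (PointedSpace.iteratedSuspension (m + 1) (PointedSpace.ofPoint c))).carrier)) ∧
    (∀ (a b : (matchingComplex (gridGraph (n - 3) 2)).realization)
        (c : (matchingComplex (gridGraph (n - 4) 2)).realization),
        Nonempty ((matchingComplex (gridGraph n 2)).realization ≃ₕ
          (((PointedSpace.iteratedSuspension 2 (PointedSpace.ofPoint a)).wedge
            (PointedSpace.iteratedSuspension 2 (PointedSpace.ofPoint b))).wedge
            (PointedSpace.iteratedSuspension 3 (PointedSpace.ofPoint c))).carrier)) := by
  refine ⟨fun m hm => ?_, ?_⟩
  · have h : ∀ d, Nonempty ((independenceComplex (braunHoughGraph m (n - d))).realization ≃ₜ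
        indepSpace (braunHoughGraph m n) (tail m n d)) := fun d =>
      nonempty_homeomorph_tail _ d (.refl _) fun s => mem_faces_independenceComplex
    exact nonempty_homotopyEquiv hm hn (h 0) (h 3) (h 4)
  · have h : ∀ d, Nonempty ((matchingComplex (gridGraph (n - d) 2)).realization ≃ₜ
        indepSpace (braunHoughGraph 2 n) (tail 2 n d)) := fun d =>
      nonempty_homeomorph_tail _ d (edgeEquiv _) fun s => mem_faces_matchingComplex
    exact nonempty_homotopyEquiv le_rfl hn (h 0) (h 3) (h 4)
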